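/- **Query model.** Let $V=\{1,\dots,n\}$ and let $G$ be a simple graph on $V$, together with an arbitrary fixed ordering of the neighbors of each vertex. A quantum query is one application of one of the following unitaries, given by $G$: the adjacency oracle $|v,u\rangle\mapsto(-1)^{A(v,u)}|v,u\rangle$, where $A(v,u)=1$ if $v$ and $u$ are adjacent and $A(v,u)=0$ otherwise; the degree oracle $|v,y\rangle\mapsto|v,y\oplus d(v)\rangle$; the neighborhood oracle $|v,j,y\rangle\mapsto|v,j,y\oplus f(v,j)\rangle$, where $f(v,j)$ is the $j$-th neighbor of $v$, or $0$ if $v$ has fewer than $j$ neighbors. A quantum algorithm may make random choices, prepare states, apply unitaries that do not depend on $G$, make queries, measure, and proceed according to the outcomes; in the end it outputs an assignment of colors to the vertices. Its number of queries is the maximum over all random choices and measurement outcomes; all other operations are free. **Corollary.** There is $k\in\mathbb N$ such that for every $\varepsilon_0>0$ there is a constant $C>0$ for which the following holds. For every $n$ and every $0<\varepsilon\le\varepsilon_0$ there is a quantum algorithm, depending only on $n$ and $\varepsilon$, that makes at most $$C\,\varepsilon^{-1}\,n^{5/4}\,(\log n)^k=\tilde O(\varepsilon^{-1}n^{5/4})$$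 queries and that, for every graph $G$ on $n$ vertices and every ordering of its neighborhoods, outputs with probability at least $2/3$ a proper coloring of $G$ with $\max\{\lfloor(1+\varepsilon)\Delta\rfloor,\ \Delta+1\}$ colors, where $\Delta$ is the maximum degree of $G$ (which is not given to the algorithm). In particular, this is a proper coloring with at most $(1+\varepsilon)\Delta$ colors whenever $\varepsilon\Delta\ge1$. -/

import Mathlib

namespace QuantumQuery

/-- The answer register of an oracle: bit strings long enough to hold every number `0, …, n`. -/
abbrev Word (n : ℕ) : Type := Fin (Nat.size n) → Bool

/-- Bitwise exclusive or of a word with the binary expansion of a natural number. -/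
def Word.xorNat {n : ℕ} (y : Word n) (a : ℕ) : Word n :=
  fun i => xor (y i) (a.testBit i)

/-- The three functions that can be queried, on the vertex set `Fin n`. -/
structure Oracle (n : ℕ) where
  /-- Are the two vertices adjacent? -/
  adj : Fin n → Fin n → Bool
  /-- The degree of a vertex. -/
  deg : Fin n → ℕ
  /-- The `j`-th neighbor `u` of a vertex, encoded as `u + 1`; the value `0` says that there is no
  `j`-th neighbor. -/
  nbr : Fin n → Fin n → ℕ

/-- The oracle of a graph whose neighborhoods are listed in a given order: the `j`-th neighbor of
`v` is `order v j` for `j < G.degree v` (counting from `0`). -/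
def graphOracle {n : ℕ} (G : SimpleGraph (Fin n)) [DecidableRel G.Adj]
    (order : ∀ v : Fin n, Fin (G.degree v) ≃ G.neighborSet v) : Oracle n where
  adj v u := decide (G.Adj v u)
  deg v := G.degree v
  nbr v j := if h : (j : ℕ) < G.degree v then ((order v ⟨j, h⟩ : Fin n) : ℕ) + 1 else 0

/-- Labels of the computational basis. The registers are, from left to right: the register `|v, u⟩`
of the adjacency oracle, the register `|v, y⟩` of the degree oracle, the register `|v, j, y⟩` of the
neighborhood oracle, and a work register with basis `W`. -/
abbrev Basis (n : ℕ) (W : Type) : Type :=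
  (Fin n × Fin n) × (Fin n × Word n) × (Fin n × Fin n × Word n) × W

instance instDecidableEqBasis (n : ℕ) (W : Type) [DecidableEq W] : DecidableEq (Basis n W) :=
  haveI : DecidableEq (Word n) := inferInstance
  haveI : DecidableEq (Fin n × Fin n × Word n) := inferInstance
  haveI : DecidableEq ((Fin n × Fin n × Word n) × W) := inferInstance
  instDecidableEqProd

/-- One step of a quantum circuit: a unitary that does not depend on the graph, or one
application of an oracle, that is, one query. -/
inductive Gate (n : ℕ) (W : Type) [Fintype W] [DecidableEq W] : Type
  | unitary (U : Matrix.unitaryGroup (Basis n W) ℂ)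
  | adjQuery
  | degQuery
  | nbrQuery

namespace Gate

variable {n : ℕ} {W : Type} [Fintype W] [DecidableEq W]

/-- The number of queries that a gate makes. -/
def cost : Gate n W → ℕ
  | unitary _ => 0
  | adjQuery => 1
  | degQuery => 1
  | nbrQuery => 1

/-- The action of a gate on a state vector, given by its amplitudes in the computational basis.
The adjacency oracle is `|v, u⟩ ↦ (-1) ^ adj(v, u) |v, u⟩`, the degree oracle is
`|v, y⟩ ↦ |v, y ⊕ deg(v)⟩`, and the neighborhood oracle is `|v, j, y⟩ ↦ |v, j, y ⊕ nbr(v, j)⟩`, each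
tensored with the identity on the other registers. The last two are self-inverse permutations of
the basis, so that their action on amplitudes is substitution. -/
noncomputable def apply (O : Oracle n) : Gate n W → (Basis n W → ℂ) → (Basis n W → ℂ)
  | .unitary U, ψ => (U : Matrix (Basis n W) (Basis n W) ℂ).mulVec ψ
  | adjQuery, ψ => fun ((v, u), d, r, w) =>
      (if O.adj v u then -1 else 1) * ψ ((v, u), d, r, w)
  | degQuery, ψ => fun (a, (v, y), r, w) => ψ (a, (v, y.xorNat (O.deg v)), r, w)
  | nbrQuery, ψ => fun (a, d, (v, j, y), w) => ψ (a, d, (v, j, y.xorNat (O.nbr v j)), w)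

/-- The state after the gates of a circuit have been applied, the first gate of the list first. -/
noncomputable def run (O : Oracle n) (gates : List (Gate n W)) (ψ : Basis n W → ℂ) :
    Basis n W → ℂ :=
  gates.foldl (fun φ g => g.apply O φ) ψ

end Gate

/-- Quantum query algorithms on vertex set `Fin n`, with classical control: an algorithm outputs an
assignment of colors to the vertices, or makes a uniformly random choice and continues depending
on it, or prepares a unit vector, applies a quantum circuit to it, measures all registers in the
computational basis and continues depending on the outcome. (A circuit with one final measurement
is the special case of a single `measure` step.) -/
inductive Algorithm (n : ℕ) : Type 1
  | output (c : Fin n → ℕ) : Algorithm n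
  | random (Ω : Type) [Fintype Ω] [Nonempty Ω] (next : Ω → Algorithm n) : Algorithm n
  | measure (W : Type) [Fintype W] [DecidableEq W] (ψ : Basis n W → ℂ)
      (unit : ∑ b, ‖ψ b‖ ^ 2 = 1) (gates : List (Gate n W))
      (next : Basis n W → Algorithm n) : Algorithm n

namespace Algorithm

variable {n : ℕ}

/-- The number of queries of all kinds that the algorithm makes, in the worst case over all random
choices and all measurement outcomes. -/
def queries : Algorithm n → ℕ
  | output _ => 0
  | random _ next => Finset.univ.sup fun ω => (next ω).queries
  | measure _ _ _ gates next =>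
      (gates.map Gate.cost).sum + Finset.univ.sup fun b => (next b).queries

open Classical in
/-- The probability that the output of the algorithm lies in `S`, when it queries the oracle `O`. -/
noncomputable def prob (O : Oracle n) (S : Set (Fin n → ℕ)) : Algorithm n → ℝ
  | output c => if c ∈ S then 1 else 0
  | random Ω next => (∑ ω, (next ω).prob O S) / Fintype.card Ω
  | measure _ ψ _ gates next => ∑ b, ‖Gate.run O gates ψ b‖ ^ 2 * (next b).prob O S

end Algorithm

/-- `c` is a proper coloring of `G` with the `K` colors `0, …, K - 1`. -/
def IsProperColoring {n : ℕ} (G : SimpleGraph (Fin n)) (K : ℕ) (c : Fin n → ℕ) : Prop :=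
  (∀ v, c v < K) ∧ ∀ u v, G.Adj u v → c u ≠ c v

/-- The number of colors in a `(1 + ε)Δ`-coloring: the integer part of `(1 + ε)Δ`, but always at
least `Δ + 1`. -/
noncomputable def numColors (ε : ℝ) (Δ : ℕ) : ℕ :=
  max ⌊(1 + ε) * Δ⌋₊ (Δ + 1)

end QuantumQuery

namespace QuantumQuery

/-! The coloring is greedy with random colors. After all degrees are read (`n` queries), each vertex
in turn draws uniform colors from a palette of size `P = numColors ε Δ` until a quantum search finds
no neighbor that already has the drawn color. At most `Δ` colors are blocked at any time
(`card_conflicts_le`), so a draw is blocked with probability at most `Δ / P`, and `O(P / (P - Δ)) =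
O(1 + 1/ε)` draws, times a logarithm, suffice with high probability.

Up to logarithms, a conflict check costs `n^(1/4)` on average. If `Δ ≤ √n`, Grover search through
the neighbor list costs `O(√Δ)`. If `Δ > √n`, Grover search through the color class with the
adjacency oracle costs the square root of the size of the class; the classes are disjoint, so by
Cauchy–Schwarz the mean over a uniform color is at most `√(n / P) ≤ n^(1/4)`
(`sum_sqrt_card_colorClass_le`). This controls the expected number of queries; truncation and
Markov's inequality (`prob_sub_prob_truncate_le`) make it a worst-case bound.

The search (`prob_search_ge`) only decides whether a marked item exists. In the plane of the initial
state `ψ` and its phase-flipped image `χ`, a Grover iteration rotates by the angle `θ` with `cos θ =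
⟨ψ, χ⟩`, so `j` iterations return to `ψ` with probability `cos² (jθ)`. Without marked items the
state never moves. Otherwise some `j` among `1, 2, 4, …`, up to about the square root of the number
of items, puts `jθ` between `π/4` and `π/2`. Hence the error is one-sided, and at most `2^(-r)`
after `r` rounds. -/

theorem sum_norm_sq_eq {ι : Type*} [Fintype ι] (ψ : ι → ℂ) :
    ((∑ b, ‖ψ b‖ ^ 2 : ℝ) : ℂ) = star ψ ⬝ᵥ ψ := by
  simp only [dotProduct, Pi.star_apply, Complex.ofReal_sum, Complex.ofReal_pow]
  refine Finset.sum_congr rfl fun b _ => ?_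
  rw [← Complex.conj_mul']; rfl

/-! ### Linearity and unitarity of gates. -/

namespace Gate

variable {n : ℕ} {W : Type} [Fintype W] [DecidableEq W]

theorem apply_add (O : Oracle n) (g : Gate n W) (φ ψ : Basis n W → ℂ) :
    g.apply O (φ + ψ) = g.apply O φ + g.apply O ψ := by
  cases g with
  | unitary U => simp [apply, Matrix.mulVec_add]
  | adjQuery => funext ⟨⟨v, u⟩, d, r, w⟩; simp [apply, mul_add]
  | degQuery => rfl
  | nbrQuery => rfl

theorem apply_smul (O : Oracle n) (g : Gate n W) (a : ℂ) (ψ : Basis n W → ℂ) :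
    g.apply O (a • ψ) = a • g.apply O ψ := by
  cases g with
  | unitary U => simp [apply, Matrix.mulVec_smul]
  | adjQuery => funext ⟨⟨v, u⟩, d, r, w⟩; simp [apply]
  | degQuery => rfl
  | nbrQuery => rfl

theorem run_add (O : Oracle n) (gs : List (Gate n W)) (φ ψ : Basis n W → ℂ) :
    run O gs (φ + ψ) = run O gs φ + run O gs ψ := by
  induction gs generalizing φ ψ with
  | nil => rfl
  | cons g gs ih => simpa [run, apply_add] using ih _ _

theorem run_smul (O : Oracle n) (gs : List (Gate n W)) (a : ℂ) (ψ : Basis n W → ℂ) :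
    run O gs (a • ψ) = a • run O gs ψ := by
  induction gs generalizing ψ with
  | nil => rfl
  | cons g gs ih => simpa [run, apply_smul] using ih _

theorem run_append (O : Oracle n) (gs hs : List (Gate n W)) (ψ : Basis n W → ℂ) :
    run O (gs ++ hs) ψ = run O hs (run O gs ψ) := by
  simp [run]

theorem xorNat_xorNat (y : Word n) (a : ℕ) : (y.xorNat a).xorNat a = y := by
  funext i; simp [Word.xorNat]

/-- The permutation of the basis performed by the degree oracle. -/
def degPerm (O : Oracle n) (W : Type) : Equiv.Perm (Basis n W) :=
  Function.Involutive.toPerm (fun b => (b.1, (b.2.1.1, b.2.1.2.xorNat (O.deg b.2.1.1)), b.2.2))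
    (fun b => by simp [xorNat_xorNat])

/-- The permutation of the basis performed by the neighborhood oracle. -/
def nbrPerm (O : Oracle n) (W : Type) : Equiv.Perm (Basis n W) :=
  Function.Involutive.toPerm
    (fun b => (b.1, b.2.1, (b.2.2.1.1, b.2.2.1.2.1,
      b.2.2.1.2.2.xorNat (O.nbr b.2.2.1.1 b.2.2.1.2.1)), b.2.2.2))
    (fun b => by simp [xorNat_xorNat])

theorem nbrPerm_symm_apply (O : Oracle n) (W : Type) (b : Basis n W) :
    (nbrPerm O W).symm b = (b.1, b.2.1, (b.2.2.1.1, b.2.2.1.2.1,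
      b.2.2.1.2.2.xorNat (O.nbr b.2.2.1.1 b.2.2.1.2.1)), b.2.2.2) := rfl

theorem apply_degQuery (O : Oracle n) (ψ : Basis n W → ℂ) :
    degQuery.apply O ψ = ψ ∘ degPerm O W := rfl

theorem apply_nbrQuery (O : Oracle n) (ψ : Basis n W → ℂ) :
    nbrQuery.apply O ψ = ψ ∘ nbrPerm O W := rfl

theorem sum_norm_sq_apply (O : Oracle n) (g : Gate n W) (ψ : Basis n W → ℂ) :
    ∑ b, ‖g.apply O ψ b‖ ^ 2 = ∑ b, ‖ψ b‖ ^ 2 := by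
  cases g with
  | unitary U =>
    apply Complex.ofReal_injective
    rw [sum_norm_sq_eq, sum_norm_sq_eq]
    simp only [apply]
    rw [Matrix.star_mulVec, Matrix.dotProduct_mulVec, Matrix.vecMul_vecMul]
    have := Matrix.mem_unitaryGroup_iff'.1 U.2
    rw [Matrix.star_eq_conjTranspose] at this
    rw [this, Matrix.vecMul_one]
  | adjQuery =>
    refine Finset.sum_congr rfl ?_
    rintro ⟨⟨v, u⟩, d, r, w⟩ -
    simp only [apply]
    split_ifs <;> simp
  | degQuery => exact Equiv.sum_comp (degPerm O W) fun b => ‖ψ b‖ ^ 2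
  | nbrQuery => exact Equiv.sum_comp (nbrPerm O W) fun b => ‖ψ b‖ ^ 2

theorem sum_norm_sq_run (O : Oracle n) (gs : List (Gate n W)) (ψ : Basis n W → ℂ) :
    ∑ b, ‖run O gs ψ b‖ ^ 2 = ∑ b, ‖ψ b‖ ^ 2 := by
  induction gs generalizing ψ with
  | nil => rfl
  | cons g gs ih => exact (ih _).trans (sum_norm_sq_apply O g ψ)

end Gate

/-! ### Success probability, expected cost and truncation. -/

namespace Algorithm

variable {n : ℕ}

theorem prob_mem_Icc (O : Oracle n) (S : Set (Fin n → ℕ)) (A : Algorithm n) :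
    A.prob O S ∈ Set.Icc 0 1 := by
  induction A with
  | output c => simp only [prob]; split_ifs <;> simp
  | random Ω next ih =>
    simp only [prob]
    have h0 : (0 : ℝ) < Fintype.card Ω := by exact_mod_cast Fintype.card_pos
    refine ⟨div_nonneg (Finset.sum_nonneg fun ω _ => (ih ω).1) h0.le, ?_⟩
    rw [div_le_one h0]
    calc _ ≤ ∑ _ω : Ω, (1 : ℝ) := Finset.sum_le_sum fun ω _ => (ih ω).2
      _ = _ := by simp
  | measure W ψ unit gates next ih =>
    simp only [prob]
    refine ⟨Finset.sum_nonneg fun b _ => mul_nonneg (sq_nonneg _) (ih b).1, ?_⟩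
    calc _ ≤ ∑ b, ‖Gate.run O gates ψ b‖ ^ 2 :=
          Finset.sum_le_sum fun b _ => mul_le_of_le_one_right (sq_nonneg _) (ih b).2
      _ = 1 := by rw [Gate.sum_norm_sq_run, unit]

theorem prob_nonneg (O : Oracle n) (S : Set (Fin n → ℕ)) (A : Algorithm n) : 0 ≤ A.prob O S :=
  (prob_mem_Icc O S A).1

theorem prob_le_one (O : Oracle n) (S : Set (Fin n → ℕ)) (A : Algorithm n) : A.prob O S ≤ 1 :=
  (prob_mem_Icc O S A).2

/-- The expected number of queries that an algorithm makes. -/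
noncomputable def expCost (O : Oracle n) : Algorithm n → ℝ
  | output _ => 0
  | random Ω next => (∑ ω, (next ω).expCost O) / Fintype.card Ω
  | measure _ ψ _ gates next =>
      (gates.map Gate.cost).sum + ∑ b, ‖Gate.run O gates ψ b‖ ^ 2 * (next b).expCost O

theorem expCost_nonneg (O : Oracle n) (A : Algorithm n) : 0 ≤ A.expCost O := by
  induction A with
  | output c => simp [expCost]
  | random Ω next ih =>
    exact div_nonneg (Finset.sum_nonneg fun ω _ => ih ω) (Nat.cast_nonneg _)
  | measure W ψ unit gates next ih =>
    exact add_nonneg (Nat.cast_nonneg _)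
      (Finset.sum_nonneg fun b _ => mul_nonneg (sq_nonneg _) (ih b))

/-- Run an algorithm, and give up before it exceeds a given number of queries. -/
noncomputable def truncate : Algorithm n → ℕ → Algorithm n
  | output c, _ => output c
  | random Ω next, B => random Ω fun ω => (next ω).truncate B
  | measure W ψ unit gates next, B =>
      if (gates.map Gate.cost).sum ≤ B then
        measure W ψ unit gates fun b => (next b).truncate (B - (gates.map Gate.cost).sum)
      else output 0

theorem queries_truncate_le (A : Algorithm n) (B : ℕ) : (A.truncate B).queries ≤ B := by
  induction A generalizing B with
  | output c => simp [truncate, queries]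
  | random Ω next ih => exact Finset.sup_le fun ω _ => ih ω B
  | measure W ψ unit gates next ih =>
    simp only [truncate]
    split_ifs with h
    · simp only [queries]
      have := Finset.sup_le (s := Finset.univ) (f := fun b =>
        ((next b).truncate (B - (gates.map Gate.cost).sum)).queries) fun b _ => ih b _
      omega
    · simp [queries]

/-- Markov's inequality for truncated algorithms. -/
theorem prob_sub_prob_truncate_le (O : Oracle n) (S : Set (Fin n → ℕ)) (A : Algorithm n) (B : ℕ) :
    ((B : ℝ) + 1) * (A.prob O S - (A.truncate B).prob O S) ≤ A.expCost O := by
  induction A generalizing B with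
  | output c => simp [truncate, expCost]
  | random Ω next ih =>
    simp only [truncate, expCost, prob]
    rw [← sub_div, ← Finset.sum_sub_distrib, mul_div_assoc', Finset.mul_sum]
    gcongr with ω
    exact ih ω B
  | measure W ψ unit gates next ih =>
    simp only [truncate]
    split_ifs with h
    · simp only [expCost, prob]
      set c := (gates.map Gate.cost).sum
      have hu : ∑ b, ‖Gate.run O gates ψ b‖ ^ 2 = 1 := by rw [Gate.sum_norm_sq_run, unit]
      rw [← Finset.sum_sub_distrib, Finset.mul_sum]
      calc _ ≤ ∑ b, (‖Gate.run O gates ψ b‖ ^ 2 * c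
              + ‖Gate.run O gates ψ b‖ ^ 2 * (next b).expCost O) := by
            refine Finset.sum_le_sum fun b _ => ?_
            rw [← mul_sub, ← mul_add, mul_left_comm]
            refine mul_le_mul_of_nonneg_left ?_ (sq_nonneg _)
            -- Induction pays for `B - c + 1` times the loss; since the loss is at most 1, the `c`
            -- queries already made cover the rest.
            have h1 := ih b (B - c)
            rw [Nat.cast_sub h] at h1
            have h2 := prob_le_one O S (next b)
            have h3 := prob_nonneg O S ((next b).truncate (B - c))
            have h4 : (0 : ℝ) ≤ c := Nat.cast_nonneg _
            nlinarith
        _ = _ := by rw [Finset.sum_add_distrib, ← Finset.sum_mul, hu, one_mul]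
    -- The run is cut off here: this circuit alone costs at least `B + 1`, and the loss of
    -- probability is at most 1.
    · have h1 := prob_le_one O S (measure W ψ unit gates next)
      have h2 := prob_nonneg O S (output (n := n) 0)
      have h3 : (0 : ℝ) ≤ ∑ b, ‖Gate.run O gates ψ b‖ ^ 2 * (next b).expCost O :=
        Finset.sum_nonneg fun b _ => mul_nonneg (sq_nonneg _) (expCost_nonneg O _)
      have h4 : (B : ℝ) + 1 ≤ ((gates.map Gate.cost).sum : ℕ) := by
        exact_mod_cast Nat.lt_of_not_le h
      have h5 : (0 : ℝ) ≤ B := Nat.cast_nonneg _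
      simp only [expCost]
      nlinarith

theorem expCost_measure_le (O : Oracle n) {W : Type} [Fintype W] [DecidableEq W]
    (ψ : Basis n W → ℂ) (unit : ∑ b, ‖ψ b‖ ^ 2 = 1) (gates : List (Gate n W))
    (next : Basis n W → Algorithm n) {X : ℝ} (h : ∀ b, (next b).expCost O ≤ X) :
    (measure W ψ unit gates next).expCost O ≤ (gates.map Gate.cost).sum + X := by
  simp only [expCost]
  have hu : ∑ b, ‖Gate.run O gates ψ b‖ ^ 2 = 1 := by rw [Gate.sum_norm_sq_run, unit]
  gcongr
  calc _ ≤ ∑ b, ‖Gate.run O gates ψ b‖ ^ 2 * X :=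
        Finset.sum_le_sum fun b _ => mul_le_mul_of_nonneg_left (h b) (sq_nonneg _)
    _ = X := by rw [← Finset.sum_mul, hu, one_mul]

end Algorithm

/-! ### Reflections about a state, and exchanging a state with a basis vector. -/

section Reflection

variable {ι : Type*} [Fintype ι] [DecidableEq ι]

/-- The reflection `2 |ψ⟩⟨ψ| - 1` about a unit vector. -/
noncomputable def reflection (ψ : ι → ℂ) (h : ∑ b, ‖ψ b‖ ^ 2 = 1) : Matrix.unitaryGroup ι ℂ :=
  ⟨(2 : ℂ) • Matrix.vecMulVec ψ (star ψ) - 1, by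
    have h1 : star ψ ⬝ᵥ ψ = 1 := by rw [← sum_norm_sq_eq, h]; simp
    have h2 : Matrix.vecMulVec ψ (star ψ) * Matrix.vecMulVec ψ (star ψ)
        = Matrix.vecMulVec ψ (star ψ) := by
      rw [Matrix.vecMulVec_mul_vecMulVec, h1]; simp
    have h3 : star (Matrix.vecMulVec ψ (star ψ)) = Matrix.vecMulVec ψ (star ψ) := by
      rw [Matrix.star_eq_conjTranspose, Matrix.conjTranspose_vecMulVec, star_star]
    rw [Matrix.mem_unitaryGroup_iff, star_sub, star_smul, h3, star_one, sub_mul, mul_sub, mul_sub,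
      smul_mul_smul_comm, h2]
    simp only [mul_one, one_mul, star_ofNat]
    module⟩

theorem reflection_mulVec (ψ : ι → ℂ) (h : ∑ b, ‖ψ b‖ ^ 2 = 1) (φ : ι → ℂ) :
    (reflection ψ h : Matrix ι ι ℂ).mulVec φ = (2 * (star ψ ⬝ᵥ φ)) • ψ - φ := by
  simp only [reflection, Matrix.sub_mulVec, Matrix.one_mulVec, Matrix.smul_mulVec,
    Matrix.vecMulVec_mulVec]
  ext b
  simp
  ring

/-- The unit vector orthogonal to the mirror that exchanges `ψ` and a basis vector, up to sign. -/
noncomputable def mirror (ψ : ι → ℂ) (b₀ : ι) : ι → ℂ :=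
  ((√2 : ℝ) : ℂ)⁻¹ • (ψ - Pi.single b₀ 1)

theorem star_mirror_dotProduct (ψ : ι → ℂ) (b₀ : ι) (φ : ι → ℂ) :
    star (mirror ψ b₀) ⬝ᵥ φ = ((√2 : ℝ) : ℂ)⁻¹ * (star ψ ⬝ᵥ φ - φ b₀) := by
  have : star (Pi.single b₀ 1 : ι → ℂ) = Pi.single b₀ 1 := by
    rw [← Pi.single_star, star_one]
  rw [mirror, star_smul, star_sub, smul_dotProduct, sub_dotProduct, this]
  simp

theorem sqrt_two_inv_sq : ((√2 : ℝ) : ℂ)⁻¹ * ((√2 : ℝ) : ℂ)⁻¹ = 2⁻¹ := by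
  rw [← mul_inv, ← Complex.ofReal_mul, Real.mul_self_sqrt (by norm_num)]
  norm_num

theorem sum_norm_sq_mirror (ψ : ι → ℂ) (b₀ : ι) (h : ∑ b, ‖ψ b‖ ^ 2 = 1) (h₀ : ψ b₀ = 0) :
    ∑ b, ‖mirror ψ b₀ b‖ ^ 2 = 1 := by
  apply Complex.ofReal_injective
  have h1 : star ψ ⬝ᵥ ψ = 1 := by rw [← sum_norm_sq_eq, h]; simp
  rw [sum_norm_sq_eq, star_mirror_dotProduct, mirror, dotProduct_smul, dotProduct_sub, h1]
  simp only [dotProduct_single, Pi.star_apply, h₀, Pi.smul_apply, Pi.sub_apply, Pi.single_eq_same,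
    smul_eq_mul, star_zero]
  rw [Complex.ofReal_one]
  linear_combination 2 * sqrt_two_inv_sq

/-- This turns a measurement in the computational basis into a test for `ψ`: after the reflection,
the amplitude at `b₀` is the overlap with `ψ`, up to sign. -/
theorem reflection_mirror_apply (ψ : ι → ℂ) (b₀ : ι) (h : ∑ b, ‖mirror ψ b₀ b‖ ^ 2 = 1)
    (h₀ : ψ b₀ = 0) (φ : ι → ℂ) :
    (reflection (mirror ψ b₀) h : Matrix ι ι ℂ).mulVec φ b₀ = -(star ψ ⬝ᵥ φ) := by
  rw [reflection_mulVec, star_mirror_dotProduct]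
  simp only [mirror, h₀, Pi.smul_apply, Pi.sub_apply, Pi.single_eq_same, smul_eq_mul]
  linear_combination (-2 * (star ψ ⬝ᵥ φ - φ b₀)) * sqrt_two_inv_sq

end Reflection

/-! ### Grover iterations and their return probability. -/

section Detection

variable {n : ℕ} {W : Type} [Fintype W] [DecidableEq W]

/-- `j` Grover iterations, and a reflection that exchanges the initial state `ψ` and the basis
vector `b₀`. -/
noncomputable def groverGates (ψ : Basis n W → ℂ) (unit : ∑ b, ‖ψ b‖ ^ 2 = 1) (b₀ : Basis n W)
    (h₀ : ψ b₀ = 0) (phase : List (Gate n W)) (j : ℕ) : List (Gate n W) :=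
  (List.replicate j (phase ++ [.unitary (reflection ψ unit)])).flatten ++
    [.unitary (reflection (mirror ψ b₀) (sum_norm_sq_mirror ψ b₀ unit h₀))]

theorem cost_groverGates (ψ : Basis n W → ℂ) (unit : ∑ b, ‖ψ b‖ ^ 2 = 1) (b₀ : Basis n W)
    (h₀ : ψ b₀ = 0) (phase : List (Gate n W)) (j : ℕ) :
    ((groverGates ψ unit b₀ h₀ phase j).map Gate.cost).sum = j * (phase.map Gate.cost).sum := by
  simp only [groverGates, List.map_append, List.sum_append, List.map_cons, List.map_nil, Gate.cost]
  rw [List.map_flatten, List.sum_flatten]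
  simp [Gate.cost]

/-- The phase gates swap `ψ` and `χ`, so the coefficients obey the Chebyshev recursion. The factor
`sin θ` avoids a division. -/
theorem run_grover_iterations (O : Oracle n) (ψ χ : Basis n W → ℂ) (unit : ∑ b, ‖ψ b‖ ^ 2 = 1)
    (phase : List (Gate n W)) (hψ : Gate.run O phase ψ = χ) (hχ : Gate.run O phase χ = ψ)
    {θ : ℝ} (hx : star ψ ⬝ᵥ χ = (Real.cos θ : ℝ)) (j : ℕ) :
    ((Real.sin θ : ℝ) : ℂ) • Gate.run O
      (List.replicate j (phase ++ [Gate.unitary (reflection ψ unit)])).flatten ψ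
      = ((Real.sin ((j + 1) * θ) : ℝ) : ℂ) • ψ - ((Real.sin (j * θ) : ℝ) : ℂ) • χ := by
  have h1 : star ψ ⬝ᵥ ψ = 1 := by rw [← sum_norm_sq_eq, unit]; simp
  induction j with
  | zero => simp [Gate.run]
  | succ j ih =>
    rw [List.replicate_succ', List.flatten_append, Gate.run_append, List.flatten_singleton,
      ← Gate.run_smul, ih, Gate.run_append, sub_eq_add_neg, ← neg_smul, Gate.run_add,
      Gate.run_smul, Gate.run_smul, hψ, hχ]
    simp only [Gate.run, List.foldl_cons, List.foldl_nil, Gate.apply]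
    rw [reflection_mulVec, dotProduct_add, dotProduct_smul, dotProduct_smul, hx, h1]
    have e : Real.sin ((j + 1 + 1) * θ)
        = 2 * Real.cos θ * Real.sin ((j + 1) * θ) - Real.sin (j * θ) := by
      have e1 : ((j : ℝ) + 1 + 1) * θ = (j + 1) * θ + θ := by ring
      have e2 : (j : ℝ) * θ = (j + 1) * θ - θ := by ring
      rw [e1, e2, Real.sin_add, Real.sin_sub]; ring
    push_cast [e]
    ext b
    simp only [Pi.sub_apply, Pi.add_apply, Pi.smul_apply, smul_eq_mul]
    ring

/-- The probability that Grover iterations return to the initial state. -/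
theorem norm_sq_run_groverGates (O : Oracle n) (ψ χ : Basis n W → ℂ)
    (unit : ∑ b, ‖ψ b‖ ^ 2 = 1) (b₀ : Basis n W) (h₀ : ψ b₀ = 0)
    (phase : List (Gate n W)) (hψ : Gate.run O phase ψ = χ) (hχ : Gate.run O phase χ = ψ)
    {θ : ℝ} (hx : star ψ ⬝ᵥ χ = (Real.cos θ : ℝ)) (hθ : Real.sin θ ≠ 0) (j : ℕ) :
    ‖Gate.run O (groverGates ψ unit b₀ h₀ phase j) ψ b₀‖ ^ 2 = Real.cos (j * θ) ^ 2 := by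
  have h1 : star ψ ⬝ᵥ ψ = 1 := by rw [← sum_norm_sq_eq, unit]; simp
  rw [groverGates, Gate.run_append]
  set φ := Gate.run O (List.replicate j (phase ++ [Gate.unitary (reflection ψ unit)])).flatten ψ
    with hφ
  have h2 := congrArg (star ψ ⬝ᵥ ·) (run_grover_iterations O ψ χ unit phase hψ hχ hx j)
  simp only [← hφ, dotProduct_smul, dotProduct_sub, h1, hx, smul_eq_mul, mul_one] at h2
  have e : Real.sin ((j + 1) * θ) - Real.sin (j * θ) * Real.cos θ
      = Real.sin θ * Real.cos (j * θ) := by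
    have e1 : ((j : ℝ) + 1) * θ = j * θ + θ := by ring
    rw [e1, Real.sin_add]; ring
  have h3 : star ψ ⬝ᵥ φ = (Real.cos (j * θ) : ℝ) := by
    have : ((Real.sin θ : ℝ) : ℂ) ≠ 0 := by exact_mod_cast hθ
    apply mul_left_cancel₀ this
    rw [h2]; exact_mod_cast e
  simp only [Gate.run, List.foldl_cons, List.foldl_nil, Gate.apply]
  rw [reflection_mirror_apply _ _ _ h₀, h3, norm_neg, Complex.norm_real, Real.norm_eq_abs, sq_abs]

/-- If no phase is flipped, Grover iterations return to the initial state with certainty. -/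
theorem norm_sq_run_groverGates_of_eq (O : Oracle n) (ψ : Basis n W → ℂ)
    (unit : ∑ b, ‖ψ b‖ ^ 2 = 1) (b₀ : Basis n W) (h₀ : ψ b₀ = 0)
    (phase : List (Gate n W)) (hψ : Gate.run O phase ψ = ψ) (j : ℕ) :
    ‖Gate.run O (groverGates ψ unit b₀ h₀ phase j) ψ b₀‖ ^ 2 = 1 := by
  have h1 : star ψ ⬝ᵥ ψ = 1 := by rw [← sum_norm_sq_eq, unit]; simp
  rw [groverGates, Gate.run_append]
  have h2 : Gate.run O
      (List.replicate j (phase ++ [Gate.unitary (reflection ψ unit)])).flatten ψ = ψ := by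
    induction j with
    | zero => rfl
    | succ j ih =>
      rw [List.replicate_succ', List.flatten_append, Gate.run_append, List.flatten_singleton, ih,
        Gate.run_append, hψ]
      simp only [Gate.run, List.foldl_cons, List.foldl_nil, Gate.apply]
      rw [reflection_mulVec, h1]
      module
  rw [h2]
  simp only [Gate.run, List.foldl_cons, List.foldl_nil, Gate.apply]
  rw [reflection_mirror_apply _ _ _ h₀, h1]
  simp

/-- Run Grover iterations for each of the given lengths in turn, until the initial state is left:
continue with `next true` in that case, and with `next false` otherwise. -/
noncomputable def detect (ψ : Basis n W → ℂ) (unit : ∑ b, ‖ψ b‖ ^ 2 = 1) (b₀ : Basis n W)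
    (h₀ : ψ b₀ = 0) (phase : List (Gate n W)) (next : Bool → Algorithm n) :
    List ℕ → Algorithm n
  | [] => next false
  | j :: js => .measure W ψ unit (groverGates ψ unit b₀ h₀ phase j) fun b =>
      if b = b₀ then detect ψ unit b₀ h₀ phase next js else next true

theorem expCost_detect_le (O : Oracle n) (ψ : Basis n W → ℂ) (unit : ∑ b, ‖ψ b‖ ^ 2 = 1)
    (b₀ : Basis n W) (h₀ : ψ b₀ = 0) (phase : List (Gate n W)) (next : Bool → Algorithm n)
    (js : List ℕ) {X : ℝ} (h : ∀ b, (next b).expCost O ≤ X) :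
    (detect ψ unit b₀ h₀ phase next js).expCost O
      ≤ (js.sum * (phase.map Gate.cost).sum : ℕ) + X := by
  induction js with
  | nil => simpa [detect] using h false
  | cons j js ih =>
    rw [detect]
    refine (Algorithm.expCost_measure_le O ψ unit _ _
      (X := (js.sum * (phase.map Gate.cost).sum : ℕ) + X) fun b => ?_).trans (le_of_eq ?_)
    · split_ifs
      · exact ih
      · exact (h true).trans (le_add_of_nonneg_left (Nat.cast_nonneg _))
    · rw [cost_groverGates, List.sum_cons]; push_cast; ring

theorem prob_detect_cons (O : Oracle n) (S : Set (Fin n → ℕ)) (ψ : Basis n W → ℂ)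
    (unit : ∑ b, ‖ψ b‖ ^ 2 = 1) (b₀ : Basis n W) (h₀ : ψ b₀ = 0) (phase : List (Gate n W))
    (next : Bool → Algorithm n) (j : ℕ) (js : List ℕ) :
    (detect ψ unit b₀ h₀ phase next (j :: js)).prob O S
      = ‖Gate.run O (groverGates ψ unit b₀ h₀ phase j) ψ b₀‖ ^ 2
          * (detect ψ unit b₀ h₀ phase next js).prob O S
        + (1 - ‖Gate.run O (groverGates ψ unit b₀ h₀ phase j) ψ b₀‖ ^ 2)
          * (next true).prob O S := by
  rw [detect, Algorithm.prob]
  have hu : ∑ b, ‖Gate.run O (groverGates ψ unit b₀ h₀ phase j) ψ b‖ ^ 2 = 1 := by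
    rw [Gate.sum_norm_sq_run, unit]
  rw [← hu, ← Finset.add_sum_erase _ _ (Finset.mem_univ b₀),
    ← Finset.add_sum_erase _ _ (Finset.mem_univ b₀), if_pos rfl, add_sub_cancel_left,
    Finset.sum_mul]
  congr 1
  refine Finset.sum_congr rfl fun b hb => ?_
  rw [if_neg (Finset.ne_of_mem_erase hb)]

theorem prob_detect_of_eq (O : Oracle n) (S : Set (Fin n → ℕ)) (ψ : Basis n W → ℂ)
    (unit : ∑ b, ‖ψ b‖ ^ 2 = 1) (b₀ : Basis n W) (h₀ : ψ b₀ = 0) (phase : List (Gate n W))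
    (hψ : Gate.run O phase ψ = ψ) (next : Bool → Algorithm n) (js : List ℕ) :
    (detect ψ unit b₀ h₀ phase next js).prob O S = (next false).prob O S := by
  induction js with
  | nil => rfl
  | cons j js ih =>
    rw [prob_detect_cons, norm_sq_run_groverGates_of_eq O ψ unit b₀ h₀ phase hψ, ih]
    ring

/-- Every circuit starts afresh from `ψ`, so the probabilities of seeing `b₀` multiply. -/
theorem prob_detect (O : Oracle n) (S : Set (Fin n → ℕ)) (ψ χ : Basis n W → ℂ)
    (unit : ∑ b, ‖ψ b‖ ^ 2 = 1) (b₀ : Basis n W) (h₀ : ψ b₀ = 0) (phase : List (Gate n W))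
    (hψ : Gate.run O phase ψ = χ) (hχ : Gate.run O phase χ = ψ)
    {θ : ℝ} (hx : star ψ ⬝ᵥ χ = (Real.cos θ : ℝ)) (hθ : Real.sin θ ≠ 0)
    (next : Bool → Algorithm n) (js : List ℕ) :
    (detect ψ unit b₀ h₀ phase next js).prob O S
      = (js.map fun j : ℕ => Real.cos (j * θ) ^ 2).prod * (next false).prob O S
        + (1 - (js.map fun j : ℕ => Real.cos (j * θ) ^ 2).prod) * (next true).prob O S := by
  induction js with
  | nil => simp [detect]
  | cons j js ih =>
    rw [prob_detect_cons, norm_sq_run_groverGates O ψ χ unit b₀ h₀ phase hψ hχ hx hθ, ih,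
      List.map_cons, List.prod_cons]
    ring

end Detection

/-! ### The schedule of iteration counts: cost and error. -/

section Sweeps

/-- The numbers of iterations to be tried when searching among `N` items: `r` times the powers of
two up to about `√N`. -/
def sweeps (r N : ℕ) : List ℕ :=
  (List.replicate r ((List.range (Nat.clog 4 N + 1)).map (2 ^ ·))).flatten

/-- Each round is a geometric sum below `2 ^ (clog 4 N + 1)`, whose square is at most `16 N` because
`4 ^ (clog 4 N - 1) < N` for `N > 1`. -/
theorem sum_sweeps_le (r N : ℕ) (hN : 0 < N) : ((sweeps r N).sum : ℝ) ≤ 4 * r * √N := by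
  have h1 : (((List.range (Nat.clog 4 N + 1)).map (2 ^ ·)).sum : ℕ) ≤ 2 ^ (Nat.clog 4 N + 1) := by
    generalize Nat.clog 4 N + 1 = m
    induction m with
    | zero => simp
    | succ m ih => rw [List.range_succ, List.map_append, List.sum_append, pow_succ]; simp; omega
  have h2 : (2 : ℝ) ^ (Nat.clog 4 N + 1) ≤ 4 * √N := by
    refine (pow_le_pow_iff_left₀ (by positivity) (by positivity) two_ne_zero).1 ?_
    rw [mul_pow, Real.sq_sqrt (Nat.cast_nonneg _), ← pow_mul, mul_comm, pow_mul]
    norm_num only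
    rcases Nat.lt_or_ge 1 N with h | h
    · have h3 := Nat.pow_pred_clog_lt_self (b := 4) (by norm_num) h
      have h4 : 0 < Nat.clog 4 N := Nat.clog_pos (by norm_num) h
      obtain ⟨m, hm⟩ := Nat.exists_eq_succ_of_ne_zero h4.ne'
      rw [hm] at h3 ⊢
      simp only [Nat.pred_succ] at h3
      have : (4 : ℝ) ^ m < N := by exact_mod_cast h3
      simp only [Nat.succ_eq_add_one, pow_succ]; linarith
    · obtain rfl : N = 1 := by omega
      norm_num
  have h3 : (sweeps r N).sum = r * ((List.range (Nat.clog 4 N + 1)).map (2 ^ ·)).sum := by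
    rw [sweeps, List.sum_flatten]; simp
  rw [h3]
  have h4 : ((((List.range (Nat.clog 4 N + 1)).map (2 ^ ·)).sum : ℕ) : ℝ) ≤ 4 * √N :=
    le_trans (by exact_mod_cast h1) h2
  rw [Nat.cast_mul]
  calc _ ≤ (r : ℝ) * (4 * √N) := by gcongr
    _ = _ := by ring

/-- Some multiple of a small angle by a power of two is between `π / 4` and `π / 2`. -/
theorem exists_cos_two_pow_sq_le {θ : ℝ} (h0 : 0 < θ) (h1 : θ ≤ Real.pi / 2) (m : ℕ)
    (hm : Real.pi / 4 ≤ 2 ^ m * θ) : ∃ i ≤ m, Real.cos (2 ^ i * θ) ^ 2 ≤ 1 / 2 := by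
  classical
  have hex : ∃ i : ℕ, Real.pi / 4 ≤ 2 ^ i * θ := ⟨m, hm⟩
  refine ⟨Nat.find hex, Nat.find_min' hex hm, ?_⟩
  have h2 : 2 ^ Nat.find hex * θ ≤ Real.pi / 2 := by
    rcases Nat.eq_zero_or_pos (Nat.find hex) with h | h
    · rw [h]; simpa using h1
    · have := Nat.find_min hex (Nat.sub_lt h one_pos)
      have e : (2 : ℝ) ^ Nat.find hex = 2 * 2 ^ (Nat.find hex - 1) := by
        rw [← pow_succ', Nat.sub_add_cancel h]
      rw [e]; linarith
  have h3 := Nat.find_spec hex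
  have h4 : Real.cos (2 ^ Nat.find hex * θ) ≤ √2 / 2 := by
    rw [← Real.cos_pi_div_four]
    exact Real.cos_le_cos_of_nonneg_of_le_pi (by positivity) (by linarith [Real.pi_pos]) h3
  have h5 : 0 ≤ Real.cos (2 ^ Nat.find hex * θ) :=
    Real.cos_nonneg_of_neg_pi_div_two_le_of_le (by linarith [Real.pi_pos]) h2
  calc _ ≤ (√2 / 2) ^ 2 := by gcongr
    _ = 1 / 2 := by rw [div_pow, Real.sq_sqrt (by norm_num)]; norm_num

theorem list_prod_le_of_mem {α : Type*} (f : α → ℝ) (h : ∀ a, f a ∈ Set.Icc 0 1) (l : List α) :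
    (l.map f).prod ∈ Set.Icc 0 1 ∧ ∀ a ∈ l, (l.map f).prod ≤ f a := by
  induction l with
  | nil => simp
  | cons b l ih =>
    obtain ⟨⟨h0, h1⟩, h2⟩ := ih
    rw [List.map_cons, List.prod_cons]
    refine ⟨⟨mul_nonneg (h b).1 h0, mul_le_one₀ (h b).2 h0 h1⟩, fun a ha => ?_⟩
    rcases List.mem_cons.1 ha with rfl | ha
    · exact mul_le_of_le_one_right (h _).1 h1
    · exact (mul_le_of_le_one_left h0 (h b).2).trans (h2 a ha)

/-- From `cos θ = x ≤ 1 - 1/N` and `1 - θ²/2 ≤ cos θ` follows `θ² ≥ 2/N`, so the largest power of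
two in a round brings the angle past `1 ≥ π/4`. Hence each of the `r` rounds contains a factor at
most `1/2`. -/
theorem prod_sweeps_le {x : ℝ} (r N : ℕ) (hN : 0 < N) (hx0 : 0 ≤ x)
    (hx1 : x ≤ 1 - 1 / N) :
    ((sweeps r N).map fun j : ℕ => Real.cos (j * Real.arccos x) ^ 2).prod ∈
      Set.Icc 0 ((1 / 2 : ℝ) ^ r) := by
  have hN' : (0 : ℝ) < N := by exact_mod_cast hN
  have hpos : (0 : ℝ) < 1 / N := by positivity
  set θ := Real.arccos x with hθ
  have hcos : Real.cos θ = x := Real.cos_arccos (by linarith) (by linarith)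
  have h0 : 0 < θ := Real.arccos_pos.2 (by linarith)
  have h1 : θ ≤ Real.pi / 2 := Real.arccos_le_pi_div_two.2 hx0
  have h2 : 2 / N ≤ θ ^ 2 := by
    have := Real.one_sub_sq_div_two_le_cos (x := θ)
    rw [hcos] at this
    have e : (2 : ℝ) / N = 2 * (1 / N) := by ring
    rw [e]; linarith
  have h3 : Real.pi / 4 ≤ 2 ^ Nat.clog 4 N * θ := by
    have h4 : (N : ℝ) ≤ 4 ^ Nat.clog 4 N := by
      exact_mod_cast Nat.le_pow_clog (by norm_num) N
    have h5 : (1 : ℝ) ^ 2 ≤ (2 ^ Nat.clog 4 N * θ) ^ 2 := by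
      rw [mul_pow, ← pow_mul, mul_comm _ 2, pow_mul]
      norm_num only
      calc (1 : ℝ) ≤ N * (2 / N) := by field_simp; norm_num
        _ ≤ _ := by gcongr
    have h6 := (pow_le_pow_iff_left₀ (by positivity) (by positivity) two_ne_zero).1 h5
    linarith [Real.pi_le_four]
  obtain ⟨i, hi, hc⟩ := exists_cos_two_pow_sq_le h0 h1 _ h3
  have h7 : ∀ j : ℕ, Real.cos (j * θ) ^ 2 ∈ Set.Icc (0 : ℝ) 1 := fun j =>
    ⟨sq_nonneg _, Real.cos_sq_le_one _⟩
  have h8 := list_prod_le_of_mem (fun j : ℕ => Real.cos (j * θ) ^ 2) h7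
    ((List.range (Nat.clog 4 N + 1)).map (2 ^ ·))
  have h9 := h8.2 (2 ^ i) (List.mem_map.2 ⟨i, List.mem_range.2 (by omega), rfl⟩)
  push_cast at h9
  rw [sweeps, List.map_flatten, List.prod_flatten, List.map_replicate, List.map_replicate,
    List.prod_replicate]
  exact ⟨pow_nonneg h8.1.1 _, pow_le_pow_left₀ h8.1.1 (h9.trans hc) _⟩

end Sweeps

/-! ### States supported on an indexed family of basis vectors. -/

section Embed

variable {I ι : Type*} [Fintype I] [DecidableEq ι]

/-- The state with amplitudes `a i` on the basis vectors `e i`. -/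
noncomputable def embed (e : I → ι) (a : I → ℂ) : ι → ℂ :=
  fun b => ∑ i, if e i = b then a i else 0

theorem embed_apply {e : I → ι} (he : Function.Injective e) (a : I → ℂ) (i : I) :
    embed e a (e i) = a i := by
  classical
  simp [embed, he.eq_iff]

theorem embed_eq_zero {e : I → ι} (a : I → ℂ) {b : ι} (h : ∀ i, e i ≠ b) :
    embed e a b = 0 := by
  simp [embed, h]

theorem star_embed_dotProduct_embed [Fintype ι] {e : I → ι} (he : Function.Injective e)
    (a a' : I → ℂ) : star (embed e a) ⬝ᵥ embed e a' = ∑ i, star (a i) * a' i := by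
  have h : ∀ b, star (embed e a b) * embed e a' b
      = ∑ i, if e i = b then star (embed e a b) * a' i else 0 := fun b => by
    rw [embed, embed, Finset.mul_sum]
    simp only [mul_ite, mul_zero]
  simp only [dotProduct, Pi.star_apply, h]
  rw [Finset.sum_comm]
  refine Finset.sum_congr rfl fun i _ => ?_
  simp [embed_apply he]

theorem embed_comp (e : I → ι) (a : I → ℂ) (σ : Equiv.Perm ι) :
    embed e a ∘ σ = embed (σ.symm ∘ e) a := by
  funext b
  simp [embed, Equiv.symm_apply_eq]

theorem mul_embed (e : I → ι) (a : I → ℂ) (s : ι → ℂ) (b : ι) :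
    s b * embed e a b = embed e (fun i => s (e i) * a i) b := by
  rw [embed, embed, Finset.mul_sum]
  refine Finset.sum_congr rfl fun i _ => ?_
  split_ifs with h
  · rw [h]
  · simp

end Embed

/-! ### Quantum search with one-sided error. -/

section Search

variable {n : ℕ}

/-- The amplitudes of the initial state of a search in `T`; half of the weight is on an additional
unmarked item. -/
noncomputable def amplitude {α : Type*} [DecidableEq α] (T : Finset α) : Option α → ℝ
  | none => (√2)⁻¹
  | some i => if i ∈ T then (√(2 * T.card))⁻¹ else 0

/-- The phases that mark the items on which `f` is true. -/
def phaseSign {α : Type*} (f : α → Bool) : Option α → ℝ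
  | none => 1
  | some i => if f i then -1 else 1

/-- The unmarked extra item of weight `1/2` makes the overlap `1 - K/|T|` instead of `1 - 2K/|T|`,
where `K` counts the marked items. It is therefore nonnegative, and the rotation angle is at most
`π/2`. -/
theorem sum_phaseSign_mul_amplitude_sq {α : Type*} [Fintype α] [DecidableEq α] (T : Finset α)
    (hT : T.Nonempty) (f : α → Bool) :
    ∑ i, phaseSign f i * amplitude T i ^ 2 = 1 - (T.filter (f ·)).card / T.card := by
  have hT' : (0 : ℝ) < T.card := by exact_mod_cast hT.card_pos
  rw [Fintype.sum_option]
  simp only [phaseSign, amplitude, ite_pow, inv_pow]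
  rw [Real.sq_sqrt (by norm_num), Real.sq_sqrt (by positivity)]
  have h : ∀ i, ((if f i then -1 else 1 : ℝ) * if i ∈ T then (2 * (T.card : ℝ))⁻¹ else 0 ^ 2)
      = if i ∈ T then (2 * (T.card : ℝ))⁻¹ - (if f i then 2 * (2 * (T.card : ℝ))⁻¹ else 0) else 0 := by
    intro i
    split_ifs <;> ring
  simp only [h]
  rw [Finset.sum_ite_mem, Finset.univ_inter, Finset.sum_sub_distrib, ← Finset.sum_filter]
  simp only [Finset.sum_const, nsmul_eq_mul]
  field_simp
  ring

/-- The initial state of a search in `T`. -/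
noncomputable def searchState {W : Type} [DecidableEq W] (e : Option (Fin n) → Basis n W) (T : Finset (Fin n)) :
    Basis n W → ℂ :=
  embed e fun i => (amplitude T i : ℂ)

theorem searchState_eq_zero {W : Type} [DecidableEq W] {e : Option (Fin n) → Basis n W} {b₀ : Basis n W}
    (h₀ : ∀ i, e i ≠ b₀) (T : Finset (Fin n)) : searchState e T b₀ = 0 :=
  embed_eq_zero _ h₀

variable {W : Type} [Fintype W] [DecidableEq W]

theorem star_searchState_dotProduct {e : Option (Fin n) → Basis n W} (he : Function.Injective e)
    {T : Finset (Fin n)} (hT : T.Nonempty) (f : Fin n → Bool) :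
    star (searchState e T) ⬝ᵥ embed e (fun i => (phaseSign f i : ℂ) * (amplitude T i : ℂ))
      = ((1 - (T.filter (f ·)).card / T.card : ℝ) : ℂ) := by
  rw [← sum_phaseSign_mul_amplitude_sq T hT f, searchState, star_embed_dotProduct_embed he]
  push_cast
  refine Finset.sum_congr rfl fun i _ => ?_
  rw [Complex.star_def, Complex.conj_ofReal]; ring

theorem phaseSign_false (i : Option (Fin n)) : phaseSign (fun _ => false) i = 1 := by
  cases i <;> simp [phaseSign]

theorem sum_norm_sq_searchState {e : Option (Fin n) → Basis n W} (he : Function.Injective e)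
    {T : Finset (Fin n)} (hT : T.Nonempty) : ∑ b, ‖searchState e T b‖ ^ 2 = 1 := by
  apply Complex.ofReal_injective
  rw [sum_norm_sq_eq]
  have := star_searchState_dotProduct he hT fun _ => false
  simpa [phaseSign_false, searchState] using this

/-- Search for a marked item in `T`, where the gates `phase` flip the phases of the basis vectors
that belong to marked items; continue with `next b`, where `b` says whether one was detected. -/
noncomputable def search (e : Option (Fin n) → Basis n W) (he : Function.Injective e)
    (b₀ : Basis n W) (h₀ : ∀ i, e i ≠ b₀) (phase : List (Gate n W)) (r : ℕ) (T : Finset (Fin n))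
    (next : Bool → Algorithm n) : Algorithm n :=
  if hT : T.Nonempty then
    detect (searchState e T) (sum_norm_sq_searchState he hT) b₀ (searchState_eq_zero h₀ T)
      phase next
      (sweeps r T.card)
  else next false

theorem expCost_search_le (O : Oracle n) (e : Option (Fin n) → Basis n W)
    (he : Function.Injective e) (b₀ : Basis n W) (h₀ : ∀ i, e i ≠ b₀) (phase : List (Gate n W))
    (r : ℕ) (T : Finset (Fin n)) (next : Bool → Algorithm n) {X : ℝ}
    (h : ∀ b, (next b).expCost O ≤ X) :
    (search e he b₀ h₀ phase r T next).expCost O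
      ≤ 4 * r * √T.card * (phase.map Gate.cost).sum + X := by
  rw [search]
  split_ifs with hT
  · refine (expCost_detect_le O _ _ _ _ _ _ _ h).trans ?_
    rw [Nat.cast_mul]
    have := sum_sweeps_le r T.card hT.card_pos
    gcongr
  · exact (h false).trans (le_add_of_nonneg_left (by positivity))

/-- Here `m` is the correct answer. If it is `false`, nothing is lost; if it is `true`, all circuits
miss with probability at most `(1 / 2) ^ r`. -/
theorem prob_search_ge (O : Oracle n) (S : Set (Fin n → ℕ)) (e : Option (Fin n) → Basis n W)
    (he : Function.Injective e) (b₀ : Basis n W) (h₀ : ∀ i, e i ≠ b₀) (phase : List (Gate n W))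
    (f : Fin n → Bool)
    (hphase : ∀ a, Gate.run O phase (embed e a) = embed e fun i => (phaseSign f i : ℂ) * a i)
    (r : ℕ) (T : Finset (Fin n)) (next : Bool → Algorithm n) (m : Bool)
    (hm : m = true ↔ ∃ i ∈ T, f i = true) :
    (next m).prob O S - (1 / 2) ^ r ≤ (search e he b₀ h₀ phase r T next).prob O S := by
  have hr : (0 : ℝ) ≤ (1 / 2) ^ r := by positivity
  rw [search]
  split_ifs with hT
  · have hT' : (0 : ℝ) < T.card := by exact_mod_cast hT.card_pos
    by_cases hK : ∃ i ∈ T, f i = true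
    · obtain rfl := hm.2 hK
      have hK' : (1 : ℝ) ≤ (T.filter (f ·)).card := by
        obtain ⟨i, hi, hf⟩ := hK
        exact_mod_cast Finset.card_pos.2 ⟨i, Finset.mem_filter.2 ⟨hi, hf⟩⟩
      have hK2 : ((T.filter (f ·)).card : ℝ) ≤ T.card := by
        exact_mod_cast Finset.card_filter_le _ _
      set x : ℝ := 1 - (T.filter (f ·)).card / T.card with hx
      have hx0 : 0 ≤ x := by rw [hx, sub_nonneg, div_le_one hT']; exact hK2
      have hx1 : x ≤ 1 - 1 / T.card := by rw [hx]; gcongr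
      have hpos : (0 : ℝ) < 1 / T.card := by positivity
      have hcos : Real.cos (Real.arccos x) = x := Real.cos_arccos (by linarith) (by linarith)
      have hsin : Real.sin (Real.arccos x) ≠ 0 := by
        refine (Real.sin_pos_of_pos_of_lt_pi (Real.arccos_pos.2 (by linarith)) ?_).ne'
        have := Real.arccos_le_pi_div_two.2 hx0
        linarith [Real.pi_pos]
      have hψ : Gate.run O phase (searchState e T) = _ := hphase _
      rw [prob_detect O S _ _ _ _ _ _ hψ (θ := Real.arccos x) ?_ ?_ hsin]
      · obtain ⟨h1, h2⟩ := prod_sweeps_le r T.card hT.card_pos hx0 hx1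
        have h3 := Algorithm.prob_nonneg O S (next false)
        have h4 := Algorithm.prob_le_one O S (next true)
        have h5 := Algorithm.prob_nonneg O S (next true)
        nlinarith [mul_nonneg h1 h3]
      -- The phase flip is an involution, so it sends `χ` back to `ψ`.
      · rw [hphase, searchState]
        congr 1
        funext i
        rw [← mul_assoc, ← Complex.ofReal_mul]
        rcases i with _ | i
        · simp [phaseSign]
        · by_cases h : f i = true <;> simp [phaseSign, h]
      · rw [hcos, hx]
        exact star_searchState_dotProduct he hT f
    · obtain rfl : m = false := by
        cases m
        · rfl
        · exact absurd (hm.1 rfl) hK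
      rw [prob_detect_of_eq]
      · linarith
      · rw [searchState, hphase]
        congr 1
        funext i
        rcases i with _ | i
        · simp [phaseSign]
        · by_cases h : f i = true
          -- Marked items outside `T` carry no amplitude, so the initial state is fixed.
          · have : i ∉ T := fun hi => hK ⟨i, hi, h⟩
            simp [amplitude, this]
          · simp [phaseSign, h]
  · obtain rfl : m = false := by
      cases m
      · rfl
      · obtain ⟨i, hi, -⟩ := hm.1 rfl
        exact absurd ⟨i, hi⟩ hT
    linarith

end Search

/-! ### Reading degrees, and searches by the two other oracles. -/

section Oracles

variable {n : ℕ}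

/-- The word that encodes a number. -/
def encode (n a : ℕ) : Word n := Word.xorNat (fun _ => false) a

theorem encode_injOn {a b : ℕ} (ha : a ≤ n) (hb : b ≤ n) (h : encode n a = encode n b) :
    a = b := by
  refine Nat.eq_of_testBit_eq fun i => ?_
  by_cases hi : i < Nat.size n
  · simpa [encode, Word.xorNat] using congrFun h ⟨i, hi⟩
  · have hn : n < 2 ^ i := (Nat.lt_size_self n).trans_le (Nat.pow_le_pow_right two_pos (not_lt.1 hi))
    rw [Nat.testBit_lt_two_pow (ha.trans_lt hn), Nat.testBit_lt_two_pow (hb.trans_lt hn)]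

/-- The number up to `n` that is encoded by a word. -/
noncomputable def decode {n : ℕ} (y : Word n) : ℕ :=
  (Function.invFun (fun a : Fin (n + 1) => encode n a) y : Fin (n + 1))

theorem decode_encode {a : ℕ} (ha : a ≤ n) : decode (encode n a) = a := by
  have hinj : Function.Injective fun a : Fin (n + 1) => encode n a := fun a b h =>
    Fin.ext (encode_injOn (Nat.lt_succ_iff.1 a.2) (Nat.lt_succ_iff.1 b.2) h)
  exact congrArg Fin.val (Function.leftInverse_invFun hinj ⟨a, Nat.lt_succ_iff.2 ha⟩)

/-- The basis vector all of whose vertex registers hold `v`, and whose answer registers are `0`. -/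
def baseVec {W : Type} (v : Fin n) (w : W) : Basis n W :=
  ((v, v), (v, encode n 0), (v, v, encode n 0), w)

theorem encode_zero_xorNat (a : ℕ) : (encode n 0).xorNat a = encode n a := by
  funext i; simp [encode, Word.xorNat]

/-- Query the degree of a vertex. -/
noncomputable def readDegree (v : Fin n) (next : ℕ → Algorithm n) : Algorithm n :=
  .measure Unit (Pi.single (baseVec v ()) 1) (by
    rw [Finset.sum_eq_single (baseVec v ())] <;> simp +contextual) [.degQuery]
    fun b => next (decode b.2.1.2)

/-- The outcome is deterministic; the arbitrary `X` serves both the success probability and the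
expected cost. -/
theorem sum_run_degQuery (O : Oracle n) (v : Fin n) (hv : O.deg v ≤ n) (X : ℕ → ℝ) :
    ∑ b, ‖Gate.run O [Gate.degQuery] (Pi.single (baseVec v ()) (1 : ℂ)) b‖ ^ 2
      * X (decode b.2.1.2) = X (O.deg v) := by
  simp only [Gate.run, List.foldl_cons, List.foldl_nil, Gate.apply_degQuery]
  rw [Finset.sum_eq_single (Gate.degPerm O Unit (baseVec v ()))]
  · have h : Gate.degPerm O Unit (Gate.degPerm O Unit (baseVec v ())) = baseVec v () :=
      (Gate.degPerm O Unit).symm_apply_apply _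
    rw [Function.comp_apply, h, Pi.single_eq_same]
    have : (Gate.degPerm O Unit (baseVec v ())).2.1.2 = encode n (O.deg v) :=
      encode_zero_xorNat _
    rw [this, decode_encode hv]
    simp
  · intro b _ hb
    rw [Function.comp_apply, Pi.single_eq_of_ne]
    · simp
    · rintro h
      exact hb (by rw [← h]; exact ((Gate.degPerm O Unit).symm_apply_apply b).symm)
  · simp

theorem prob_readDegree (O : Oracle n) (S : Set (Fin n → ℕ)) (v : Fin n) (hv : O.deg v ≤ n)
    (next : ℕ → Algorithm n) :
    (readDegree v next).prob O S = (next (O.deg v)).prob O S := by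
  rw [readDegree, Algorithm.prob]
  exact sum_run_degQuery O v hv fun a => (next a).prob O S

theorem expCost_readDegree (O : Oracle n) (v : Fin n) (hv : O.deg v ≤ n)
    (next : ℕ → Algorithm n) :
    (readDegree v next).expCost O = 1 + (next (O.deg v)).expCost O := by
  rw [readDegree, Algorithm.expCost, sum_run_degQuery O v hv fun a => (next a).expCost O]
  simp [Gate.cost]

/-- Query the degrees of the vertices of a list. -/
noncomputable def readDegrees (next : (Fin n → ℕ) → Algorithm n) :
    List (Fin n) → (Fin n → ℕ) → Algorithm n
  | [], d => next d
  | v :: l, d => readDegree v fun a => readDegrees next l (Function.update d v a)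

theorem readDegrees_spec (O : Oracle n) (hO : ∀ v, O.deg v ≤ n) (S : Set (Fin n → ℕ))
    (next : (Fin n → ℕ) → Algorithm n) (l : List (Fin n)) (d : Fin n → ℕ)
    (hd : ∀ v, v ∉ l → d v = O.deg v) :
    (readDegrees next l d).prob O S = (next O.deg).prob O S ∧
      (readDegrees next l d).expCost O = l.length + (next O.deg).expCost O := by
  induction l generalizing d with
  | nil =>
    obtain rfl : d = O.deg := funext fun v => hd v (by simp)
    simp [readDegrees]
  | cons v l ih =>
    have := ih (Function.update d v (O.deg v)) fun u hu => by
      by_cases h : u = v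
      · subst h; simp
      · rw [Function.update_of_ne h]; exact hd u (by simp [h, hu])
    rw [readDegrees, prob_readDegree O S v (hO v), expCost_readDegree O v (hO v), this.1, this.2]
    refine ⟨rfl, ?_⟩
    simp only [List.length_cons]; push_cast; ring

/-- The basis vectors for a search by the adjacency oracle. -/
def adjIndex (v : Fin n) : Option (Fin n) → Basis n (Fin 3)
  | none => baseVec v 1
  | some u => ((v, u), (baseVec v (0 : Fin 3)).2)

theorem adjIndex_injective (v : Fin n) : Function.Injective (adjIndex v) := by
  rintro (_ | a) (_ | b) h <;> simp_all [adjIndex, baseVec]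

theorem adjIndex_ne (v : Fin n) (i : Option (Fin n)) : adjIndex v i ≠ baseVec v 2 := by
  cases i <;> simp [adjIndex, baseVec]

/-- Search for a neighbor of `v` in `T` by the adjacency oracle. -/
noncomputable def adjSearch (v : Fin n) (r : ℕ) (T : Finset (Fin n))
    (next : Bool → Algorithm n) : Algorithm n :=
  search (adjIndex v) (adjIndex_injective v) (baseVec v 2) (adjIndex_ne v) [.adjQuery] r T next

theorem run_adjQuery (O : Oracle n) (v : Fin n) (hv : O.adj v v = false)
    (a : Option (Fin n) → ℂ) :
    Gate.run O [Gate.adjQuery] (embed (adjIndex v) a)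
      = embed (adjIndex v) fun i => (phaseSign (O.adj v) i : ℂ) * a i := by
  have h : ∀ i, (if O.adj (adjIndex v i).1.1 (adjIndex v i).1.2 then -1 else 1 : ℂ)
      = phaseSign (O.adj v) i := by
    rintro (_ | u)
    -- The extra item sits on the pair `(v, v)`, which is unmarked as there are no loops.
    · simp [adjIndex, baseVec, phaseSign, hv]
    · by_cases hu : O.adj v u = true <;> simp [adjIndex, phaseSign, hu]
  simp only [← h]
  funext b
  exact mul_embed (adjIndex v) a (fun b => if O.adj b.1.1 b.1.2 then -1 else 1) b

/-- The basis vectors for a search by the neighborhood oracle. -/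
def nbrIndex (v : Fin n) : Option (Fin n) → Basis n (Fin 3)
  | none => baseVec v 1
  | some j => ((v, v), (v, encode n 0), (v, j, encode n 0), 0)

theorem nbrIndex_injective (v : Fin n) : Function.Injective (nbrIndex v) := by
  rintro (_ | a) (_ | b) h <;> simp_all [nbrIndex, baseVec]

theorem nbrIndex_ne (v : Fin n) (i : Option (Fin n)) : nbrIndex v i ≠ baseVec v 2 := by
  cases i <;> simp [nbrIndex, baseVec]

/-- The unitary that multiplies the basis vectors in `s` by `-1`. -/
noncomputable def flipSign {ι : Type*} [Fintype ι] [DecidableEq ι] (s : ι → Bool) :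
    Matrix.unitaryGroup ι ℂ :=
  ⟨Matrix.diagonal fun b => if s b then -1 else 1, by
    rw [Matrix.mem_unitaryGroup_iff, Matrix.star_eq_conjTranspose, Matrix.diagonal_conjTranspose,
      Matrix.diagonal_mul_diagonal, ← Matrix.diagonal_one]
    congr 1
    funext b
    by_cases h : s b = true <;> simp [h]⟩

/-- Mark the basis vectors whose answer register encodes a vertex in `T`. -/
def markWord (T : Finset (Fin n)) (b : Basis n (Fin 3)) : Bool :=
  decide (b.2.2.2 = 0 ∧ ∃ u ∈ T, b.2.2.1.2.2 = encode n (u + 1))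

/-- Search for a neighbor of `v` in `T` among the first `d` neighbors by the neighborhood oracle. -/
noncomputable def nbrSearch (v : Fin n) (r d : ℕ) (T : Finset (Fin n))
    (next : Bool → Algorithm n) : Algorithm n :=
  search (nbrIndex v) (nbrIndex_injective v) (baseVec v 2) (nbrIndex_ne v)
    [.nbrQuery, .unitary (flipSign (markWord T)), .nbrQuery] r
    (Finset.univ.filter fun j : Fin n => (j : ℕ) < d) next

/-- Query, flip the sign according to the answer, and query again to erase the answer. -/
theorem run_nbrQuery (O : Oracle n) (v : Fin n) (T : Finset (Fin n))
    (a : Option (Fin n) → ℂ) :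
    Gate.run O [Gate.nbrQuery, Gate.unitary (flipSign (markWord T)), Gate.nbrQuery]
        (embed (nbrIndex v) a)
      = embed (nbrIndex v) fun i => (phaseSign (fun j =>
          decide (∃ u ∈ T, encode n (O.nbr v j) = encode n (u + 1))) i : ℂ) * a i := by
  simp only [Gate.run, List.foldl_cons, List.foldl_nil, Gate.apply_nbrQuery]
  funext b
  rw [Function.comp_apply, Gate.apply, flipSign, Matrix.mulVec_diagonal, embed_comp,
    mul_embed _ _ (fun b => if markWord T b then -1 else 1)]
  have h1 := congrFun (embed_comp ((Gate.nbrPerm O (Fin 3)).symm ∘ nbrIndex v)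
    (fun i => (if markWord T (((Gate.nbrPerm O (Fin 3)).symm ∘ nbrIndex v) i) then -1 else 1) * a i)
    (Gate.nbrPerm O (Fin 3))) b
  rw [Function.comp_apply] at h1
  rw [h1]
  have h2 : (Gate.nbrPerm O (Fin 3)).symm ∘ (Gate.nbrPerm O (Fin 3)).symm ∘ nbrIndex v
      = nbrIndex v := funext fun i => (Gate.nbrPerm O (Fin 3)).symm_apply_apply _
  rw [h2]
  congr 1
  funext i
  congr 1
  rcases i with _ | j
  -- The extra item is queried too, but its work label `1` keeps it unmarked.
  · simp [Gate.nbrPerm_symm_apply, markWord, nbrIndex, baseVec, phaseSign]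
  · have h3 : markWord T (((Gate.nbrPerm O (Fin 3)).symm ∘ nbrIndex v) (some j))
        = decide (∃ u ∈ T, encode n (O.nbr v j) = encode n (u + 1)) := by
      simp [Gate.nbrPerm_symm_apply, markWord, nbrIndex, encode_zero_xorNat]
    rw [h3, phaseSign]
    split_ifs <;> simp

end Oracles

/-! ### Correctness of the searches on graph oracles. -/

section Graphs

variable {n : ℕ} (G : SimpleGraph (Fin n)) [DecidableRel G.Adj]
  (order : ∀ v : Fin n, Fin (G.degree v) ≃ G.neighborSet v)

theorem prob_adjSearch_ge (S : Set (Fin n → ℕ)) (v : Fin n) (r : ℕ) (T : Finset (Fin n))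
    (next : Bool → Algorithm n) :
    (next (decide (∃ u ∈ T, G.Adj v u))).prob (graphOracle G order) S - (1 / 2) ^ r
      ≤ (adjSearch v r T next).prob (graphOracle G order) S := by
  refine prob_search_ge _ S _ _ _ _ _ ((graphOracle G order).adj v) (run_adjQuery _ v ?_) r T next
    _ ?_
  · simp [graphOracle]
  · simp [graphOracle]

theorem prob_nbrSearch_ge (S : Set (Fin n → ℕ)) (v : Fin n) (r : ℕ) (T : Finset (Fin n))
    (next : Bool → Algorithm n) :
    (next (decide (∃ u ∈ T, G.Adj v u))).prob (graphOracle G order) S - (1 / 2) ^ r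
      ≤ (nbrSearch v r (G.degree v) T next).prob (graphOracle G order) S := by
  refine prob_search_ge _ S _ _ _ _ _ _ (run_nbrQuery _ v T) r _ next _ ?_
  simp only [decide_eq_true_eq, Finset.mem_filter, Finset.mem_univ, true_and]
  constructor
  · rintro ⟨u, hu, huv⟩
    set k := (order v).symm ⟨u, huv⟩ with hk
    have hkn : (k : ℕ) < n := k.2.trans_le
      ((G.degree_lt_card_verts v).le.trans_eq (Fintype.card_fin n))
    refine ⟨⟨k, hkn⟩, k.2, u, hu, ?_⟩
    simp [graphOracle, hk]
  · rintro ⟨j, hj, u, hu, h⟩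
    simp only [graphOracle, hj, dif_pos] at h
    have h1 := encode_injOn (Nat.succ_le_of_lt (Fin.is_lt _)) (Nat.succ_le_of_lt u.is_lt) h
    have h2 : ((order v ⟨j, hj⟩ : G.neighborSet v) : Fin n) = u := Fin.ext (by omega)
    exact ⟨u, hu, h2 ▸ (order v ⟨j, hj⟩).2⟩

end Graphs

/-! ### Greedy coloring by random trials. -/

section Greedy

variable {n : ℕ}

/-- The vertices that have a given color in a partial coloring. -/
def colorClass (col : Fin n → Option ℕ) (c : ℕ) : Finset (Fin n) :=
  Finset.univ.filter fun u => col u = some c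

/-- Try up to `t` random colors for the vertex `v`, where `find T` searches for a neighbor of `v`
in `T`; continue with the extended partial coloring when no conflict is found. -/
noncomputable def colorVertex (find : Finset (Fin n) → (Bool → Algorithm n) → Algorithm n)
    (P : ℕ) [NeZero P] (col : Fin n → Option ℕ) (v : Fin n)
    (next : (Fin n → Option ℕ) → Algorithm n) : ℕ → Algorithm n
  | 0 => .output 0
  | t + 1 => .random (Fin P) fun c => find (colorClass col c) fun b =>
      if b then colorVertex find P col v next t else next (Function.update col v (some (c : ℕ)))

/-- Color the vertices of a list one after the other. -/
noncomputable def greedy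
    (find : Fin n → Finset (Fin n) → (Bool → Algorithm n) → Algorithm n)
    (P : ℕ) [NeZero P] (t : ℕ) : List (Fin n) → (Fin n → Option ℕ) → Algorithm n
  | [], col => .output fun v => (col v).getD 0
  | v :: l, col => colorVertex (find v) P col v (greedy find P t l) t

theorem sum_card_colorClass_le (P : ℕ) (col : Fin n → Option ℕ) :
    ∑ c : Fin P, (colorClass col c).card ≤ n := by
  simp only [colorClass, Finset.card_filter]
  rw [Finset.sum_comm]
  calc _ ≤ ∑ _u : Fin n, 1 := Finset.sum_le_sum fun u _ => ?_
    _ = n := by simp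
  rw [← Finset.card_filter, Finset.card_le_one]
  intro a ha b hb
  simp only [Finset.mem_filter, Finset.mem_univ, true_and] at ha hb
  exact Fin.ext (Option.some_injective _ (ha.symm.trans hb))

/-- The color is uniform, so a trial costs at most the mean `κ₀` of `κ` over the classes. Nothing is
assumed about `col` being proper, so earlier search errors do not affect the cost. -/
theorem expCost_colorVertex_le (O : Oracle n)
    (find : Finset (Fin n) → (Bool → Algorithm n) → Algorithm n) (P : ℕ) [NeZero P]
    (col : Fin n → Option ℕ) (v : Fin n) (next : (Fin n → Option ℕ) → Algorithm n)
    (κ : Finset (Fin n) → ℝ) (κ₀ : ℝ)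
    (hfind : ∀ T nx X, (∀ b, (nx b : Algorithm n).expCost O ≤ X) →
      (find T nx).expCost O ≤ κ T + X)
    (hκ : ∑ c : Fin P, κ (colorClass col c) ≤ P * κ₀) (hκ₀ : 0 ≤ κ₀)
    {X : ℝ} (hX : 0 ≤ X) (h : ∀ col', (next col').expCost O ≤ X) (t : ℕ) :
    (colorVertex find P col v next t).expCost O ≤ t * κ₀ + X := by
  induction t with
  | zero => simpa [colorVertex, Algorithm.expCost] using hX
  | succ t ih =>
    have hP : (0 : ℝ) < P := by exact_mod_cast Nat.pos_of_ne_zero (NeZero.ne P)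
    rw [colorVertex, Algorithm.expCost, Fintype.card_fin, div_le_iff₀ hP]
    calc _ ≤ ∑ c : Fin P, (κ (colorClass col c) + (t * κ₀ + X)) := by
          refine Finset.sum_le_sum fun c _ => hfind _ _ _ fun b => ?_
          split_ifs
          · exact ih
          · exact (h _).trans (le_add_of_nonneg_left (by positivity))
      _ = ∑ c : Fin P, κ (colorClass col c) + P * (t * κ₀ + X) := by
          rw [Finset.sum_add_distrib]; simp [mul_add]
      _ ≤ P * κ₀ + P * (t * κ₀ + X) := by gcongr
      _ = _ := by push_cast; ring

theorem expCost_greedy_le (O : Oracle n)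
    (find : Fin n → Finset (Fin n) → (Bool → Algorithm n) → Algorithm n) (P : ℕ) [NeZero P]
    (κ : Finset (Fin n) → ℝ) (κ₀ : ℝ)
    (hfind : ∀ v T nx X, (∀ b, (nx b : Algorithm n).expCost O ≤ X) →
      (find v T nx).expCost O ≤ κ T + X)
    (hκ : ∀ col : Fin n → Option ℕ, ∑ c : Fin P, κ (colorClass col c) ≤ P * κ₀) (hκ₀ : 0 ≤ κ₀)
    (t : ℕ) (l : List (Fin n)) (col : Fin n → Option ℕ) :
    (greedy find P t l col).expCost O ≤ l.length * (t * κ₀) := by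
  induction l generalizing col with
  | nil => simp [greedy, Algorithm.expCost]
  | cons v l ih =>
    refine (expCost_colorVertex_le O (find v) P col v _ κ κ₀ (hfind v) (hκ col) hκ₀
      (by positivity) ih t).trans (le_of_eq ?_)
    rw [List.length_cons]; push_cast; ring

variable (G : SimpleGraph (Fin n)) [DecidableRel G.Adj]

/-- A neighbor blocks only its own color, so choosing a witness for each blocked color is injective.
-/
theorem card_conflicts_le (P : ℕ) (col : Fin n → Option ℕ) (v : Fin n) :
    (Finset.univ.filter fun c : Fin P => ∃ u ∈ colorClass col c, G.Adj v u).card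
      ≤ G.maxDegree := by
  refine le_trans ?_ (G.degree_le_maxDegree v)
  rw [← G.card_neighborFinset_eq_degree]
  have h : ∀ c : Fin P, ∃ u, (∃ u ∈ colorClass col c, G.Adj v u) →
      u ∈ colorClass col c ∧ G.Adj v u := fun c => by
    by_cases hc : ∃ u ∈ colorClass col c, G.Adj v u
    · exact ⟨hc.choose, fun _ => hc.choose_spec⟩
    · exact ⟨v, fun h => absurd h hc⟩
  choose f hf using h
  refine Finset.card_le_card_of_injOn f (fun c hc => ?_) fun a ha b hb hab => ?_
  · simpa using (hf c (Finset.mem_filter.1 hc).2).2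
  · have h1 := (hf a (Finset.mem_filter.1 ha).2).1
    have h2 := (hf b (Finset.mem_filter.1 hb).2).1
    rw [hab] at h1
    simp only [colorClass, Finset.mem_filter, Finset.mem_univ, true_and] at h1 h2
    exact Fin.ext (Option.some_injective _ (h1.symm.trans h2))

/-- Each search errs with probability at most `δ`, and all `t` draws are blocked with probability at
most `(Δ / P) ^ t`: a blocked draw, of probability at most `Δ / P`, leaves the induction hypothesis
for the remaining trials. -/
theorem prob_colorVertex_ge (O : Oracle n) (S : Set (Fin n → ℕ))
    (find : Finset (Fin n) → (Bool → Algorithm n) → Algorithm n) (P : ℕ) [NeZero P]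
    (col : Fin n → Option ℕ) (v : Fin n) (next : (Fin n → Option ℕ) → Algorithm n)
    {δ : ℝ} (hδ : 0 ≤ δ)
    (hfind : ∀ T nx, (nx (decide (∃ u ∈ T, G.Adj v u)) : Algorithm n).prob O S - δ
      ≤ (find T nx).prob O S)
    {p : ℝ} (hp : p ≤ 1)
    (h : ∀ c < P, (∀ u, G.Adj v u → col u ≠ some c) →
      p ≤ (next (Function.update col v (some c))).prob O S) (t : ℕ) :
    p - t * δ - ((G.maxDegree : ℝ) / P) ^ t ≤ (colorVertex find P col v next t).prob O S := by
  induction t with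
  | zero =>
    have := Algorithm.prob_nonneg O S (colorVertex find P col v next 0)
    simp only [pow_zero, Nat.cast_zero, zero_mul]
    linarith
  | succ t ih =>
    have hP : (0 : ℝ) < P := by exact_mod_cast Nat.pos_of_ne_zero (NeZero.ne P)
    rw [colorVertex, Algorithm.prob, Fintype.card_fin, le_div_iff₀ hP]
    set ρ : ℝ := (G.maxDegree : ℝ) / P with hρ
    have hρ0 : 0 ≤ ρ := by positivity
    have key : ∀ c : Fin P, p - (t + 1) * δ
        - (if ∃ u ∈ colorClass col c, G.Adj v u then ρ ^ t else 0)
        ≤ (find (colorClass col c) fun b => if b then colorVertex find P col v next t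
            else next (Function.update col v (some (c : ℕ)))).prob O S := by
      intro c
      refine le_trans ?_ (hfind _ _)
      by_cases hc : ∃ u ∈ colorClass col c, G.Adj v u
      · simp only [hc, decide_true, if_true]
        linarith
      · simp only [hc, decide_false, Bool.false_eq_true, if_false]
        have := h c c.2 fun u hu huc => hc ⟨u, by simp [colorClass, huc], hu⟩
        have : 0 ≤ t * δ := by positivity
        linarith
    refine le_trans ?_ (Finset.sum_le_sum fun c _ => key c)
    rw [Finset.sum_sub_distrib, ← Finset.sum_filter]
    simp only [Finset.sum_const, Finset.card_univ, Fintype.card_fin, nsmul_eq_mul]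
    have h1 : ((Finset.univ.filter fun c : Fin P => ∃ u ∈ colorClass col c, G.Adj v u).card : ℝ)
        ≤ G.maxDegree := by exact_mod_cast card_conflicts_le G P col v
    have h2 : (G.maxDegree : ℝ) = ρ * P := by rw [hρ]; field_simp
    rw [h2] at h1
    have h3 := mul_le_mul_of_nonneg_right h1 (pow_nonneg hρ0 t)
    push_cast
    rw [pow_succ]
    linarith

theorem prob_greedy_ge (O : Oracle n)
    (find : Fin n → Finset (Fin n) → (Bool → Algorithm n) → Algorithm n) (P : ℕ) [NeZero P]
    {δ : ℝ} (hδ : 0 ≤ δ)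
    (hfind : ∀ v T nx, (nx (decide (∃ u ∈ T, G.Adj v u)) : Algorithm n).prob O
      {c | IsProperColoring G P c} - δ ≤ (find v T nx).prob O {c | IsProperColoring G P c})
    (t : ℕ) (l : List (Fin n)) (col : Fin n → Option ℕ)
    (hcol : ∀ u w c, G.Adj u w → col u = some c → col w ≠ some c)
    (hl : ∀ u, u ∉ l → ∃ c < P, col u = some c) :
    1 - l.length * (t * δ + ((G.maxDegree : ℝ) / P) ^ t)
      ≤ (greedy find P t l col).prob O {c | IsProperColoring G P c} := by
  induction l generalizing col with
  | nil =>
    have h : IsProperColoring G P fun v => (col v).getD 0 := by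
      constructor
      · intro v
        obtain ⟨c, hc, hv⟩ := hl v (by simp)
        simpa [hv] using hc
      · intro u w huw h
        obtain ⟨c, hc, hu⟩ := hl u (by simp)
        obtain ⟨c', hc', hw⟩ := hl w (by simp)
        simp only [hu, hw, Option.getD_some] at h
        exact hcol u w c huw hu (h ▸ hw)
    simp [greedy, Algorithm.prob, h]
  | cons v l ih =>
    have hnn : 0 ≤ (l.length : ℝ) * (t * δ + ((G.maxDegree : ℝ) / P) ^ t) := by positivity
    refine le_trans (le_of_eq ?_) (prob_colorVertex_ge G O _ (find v) P col v
      (greedy find P t l) hδ (hfind v)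
      (p := 1 - l.length * (t * δ + ((G.maxDegree : ℝ) / P) ^ t)) (by linarith) ?_ t)
    · rw [List.length_cons]; push_cast; ring
    · intro c hc hv
      refine ih _ ?_ ?_
      · intro u w a huw hu hw
        by_cases huv : u = v
        · subst huv
          rw [Function.update_self] at hu
          rw [Function.update_of_ne huw.ne'] at hw
          exact hv w huw (by rw [hw, ← hu])
        · rw [Function.update_of_ne huv] at hu
          by_cases hwv : w = v
          · subst hwv
            rw [Function.update_self] at hw
            exact hv u huw.symm (by rw [hu, ← hw])
          · rw [Function.update_of_ne hwv] at hw
            exact hcol u w a huw hu hw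
      · intro u hu
        by_cases huv : u = v
        · subst huv; exact ⟨c, hc, by simp⟩
        · rw [Function.update_of_ne huv]
          exact hl u (by simp [huv, hu])

end Greedy

/-! ### The number of trials. -/

section Parameters

theorem lt_numColors (ε : ℝ) (Δ : ℕ) : Δ < numColors ε Δ :=
  Nat.lt_of_succ_le (le_max_right _ _)

instance (ε : ℝ) (Δ : ℕ) : NeZero (numColors ε Δ) := ⟨(Nat.zero_lt_of_lt (lt_numColors ε Δ)).ne'⟩

/-- The inverse of the fraction of colors that are always available, rounded up. -/
noncomputable def trialFactor (ε : ℝ) (Δ : ℕ) : ℕ :=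
  ⌈(numColors ε Δ : ℝ) / (numColors ε Δ - Δ)⌉₊

theorem one_le_numColors_sub (ε : ℝ) (Δ : ℕ) : (1 : ℝ) ≤ numColors ε Δ - Δ := by
  have : ((Δ + 1 : ℕ) : ℝ) ≤ numColors ε Δ := by exact_mod_cast lt_numColors ε Δ
  push_cast at this; linarith

theorem numColors_div_eq (ε : ℝ) (Δ : ℕ) :
    (numColors ε Δ : ℝ) / (numColors ε Δ - Δ) = 1 + Δ / (numColors ε Δ - Δ) := by
  have := one_le_numColors_sub ε Δ
  have h : (numColors ε Δ : ℝ) - Δ ≠ 0 := by linarith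
  field_simp
  ring

/-- A bound independent of `ε`, needed for the error estimate; the next one is for the cost. -/
theorem trialFactor_le_succ (ε : ℝ) (Δ : ℕ) : trialFactor ε Δ ≤ Δ + 1 := by
  have := one_le_numColors_sub ε Δ
  rw [trialFactor, Nat.ceil_le, numColors_div_eq]
  push_cast
  rw [add_comm]
  gcongr
  exact div_le_self (Nat.cast_nonneg _) this

theorem trialFactor_le {ε : ℝ} (hε : 0 < ε) (Δ : ℕ) : (trialFactor ε Δ : ℝ) ≤ 2 + 2 / ε := by
  have h1 := one_le_numColors_sub ε Δ
  have h2 : (1 + ε) * Δ - 1 ≤ numColors ε Δ := by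
    have h3 := Nat.lt_floor_add_one ((1 + ε) * Δ)
    have h4 : ((⌊(1 + ε) * Δ⌋₊ : ℕ) : ℝ) ≤ numColors ε Δ := by
      exact_mod_cast le_max_left _ _
    linarith
  -- The surplus of colors is at least `1` and at least `εΔ - 1`, so twice the surplus is at least
  -- `εΔ`.
  have h5 : (Δ : ℝ) / (numColors ε Δ - Δ) ≤ 2 / ε := by
    rw [div_le_div_iff₀ (by linarith) hε]
    linarith
  have h6 := Nat.ceil_lt_add_one (a := (numColors ε Δ : ℝ) / (numColors ε Δ - Δ)) (by positivity)
  rw [trialFactor]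
  have h7 := numColors_div_eq ε Δ
  linarith

/-- By `x ≤ exp (-(1 - x))`, each block of `trialFactor ε Δ` trials gains a factor `1/e ≤ 1/2`. -/
theorem div_numColors_pow_le (ε : ℝ) (Δ L : ℕ) :
    ((Δ : ℝ) / numColors ε Δ) ^ (trialFactor ε Δ * L) ≤ (1 / 2) ^ L := by
  have h1 := one_le_numColors_sub ε Δ
  have hP : (0 : ℝ) < numColors ε Δ := by
    have : (0 : ℝ) ≤ Δ := Nat.cast_nonneg _
    linarith
  rw [pow_mul]
  refine pow_le_pow_left₀ (by positivity) ?_ L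
  set x : ℝ := (Δ : ℝ) / numColors ε Δ with hx
  have h2 : x ≤ Real.exp (-(1 - x)) := by
    have := Real.add_one_le_exp (-(1 - x)); linarith
  have h3 : 1 ≤ trialFactor ε Δ * (1 - x) := by
    have h4 : (numColors ε Δ : ℝ) / (numColors ε Δ - Δ) ≤ trialFactor ε Δ := Nat.le_ceil _
    have h5 : 1 - x = (numColors ε Δ - Δ) / numColors ε Δ := by rw [hx]; field_simp
    rw [h5]
    rw [div_le_iff₀ (by linarith)] at h4
    rw [mul_div_assoc', le_div_iff₀ hP]
    linarith
  calc x ^ trialFactor ε Δ ≤ Real.exp (-(1 - x)) ^ trialFactor ε Δ := by gcongr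
    _ = Real.exp (-(trialFactor ε Δ * (1 - x))) := by rw [← Real.exp_nat_mul]; ring_nf
    _ ≤ Real.exp (-1) := by gcongr
    _ ≤ 1 / 2 := by
      rw [Real.exp_neg, one_div]
      gcongr
      have := Real.add_one_le_exp 1; linarith

end Parameters

/-! ### Cost and success probability of the coloring algorithm. -/

section Coloring

variable {n : ℕ}

/-- Search for a neighbor of `v` in `T` by one of the two oracles. -/
noncomputable def conflictSearch (useNbr : Bool) (r : ℕ) (d : Fin n → ℕ) (v : Fin n)
    (T : Finset (Fin n)) (next : Bool → Algorithm n) : Algorithm n :=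
  if useNbr then nbrSearch v r (d v) T next else adjSearch v r T next

/-- The logarithmic factor that controls all error probabilities. -/
def logFactor (n : ℕ) : ℕ := Nat.size n + 4

/-- Color greedily with random colors, where the degrees and the maximum degree are known. Conflicts
are searched for by the neighborhood oracle if the maximum degree is at most `√n`, and by the
adjacency oracle otherwise. -/
noncomputable def greedyColoring (n : ℕ) (ε : ℝ) (d : Fin n → ℕ) (Δ : ℕ) : Algorithm n :=
  greedy (conflictSearch (decide (Δ ^ 2 ≤ n)) (3 * logFactor n) d) (numColors ε Δ)
    (trialFactor ε Δ * logFactor n) (List.finRange n) fun _ => none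

/-- Read all degrees, and color greedily with random colors. -/
noncomputable def coloringAlgorithm (n : ℕ) (ε : ℝ) : Algorithm n :=
  readDegrees (fun d => greedyColoring n ε d (Finset.univ.sup d)) (List.finRange n) 0

variable (G : SimpleGraph (Fin n)) [DecidableRel G.Adj]

theorem sup_degree_eq : (Finset.univ.sup fun v => G.degree v) = G.maxDegree := by
  apply le_antisymm
  · exact Finset.sup_le fun v _ => G.degree_le_maxDegree v
  · exact G.maxDegree_le_of_forall_degree_le _ fun v =>
      Finset.le_sup (f := fun v => G.degree v) (Finset.mem_univ v)

/-- Cauchy–Schwarz with disjoint classes; `x` stands for `n^(1/4)`. -/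
theorem sum_sqrt_card_colorClass_le {P : ℕ} {x : ℝ} (hx : 0 ≤ x) (hxn : x ^ 4 = n)
    (hP : x ^ 2 ≤ P) (col : Fin n → Option ℕ) :
    ∑ c : Fin P, √(colorClass col c).card ≤ P * x := by
  have h1 := sq_sum_le_card_mul_sum_sq (s := (Finset.univ : Finset (Fin P)))
    (f := fun c => √((colorClass col c).card : ℝ))
  simp only [Real.sq_sqrt (Nat.cast_nonneg _), Finset.card_univ, Fintype.card_fin] at h1
  have h2 : ∑ c : Fin P, ((colorClass col c).card : ℝ) ≤ n := by
    exact_mod_cast sum_card_colorClass_le P col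
  refine (pow_le_pow_iff_left₀ (Finset.sum_nonneg fun _ _ => Real.sqrt_nonneg _) (by positivity)
    two_ne_zero).1 (h1.trans ?_)
  calc (P : ℝ) * ∑ c : Fin P, ((colorClass col c).card : ℝ) ≤ P * (x ^ 2 * x ^ 2) := by
        rw [← hxn] at h2
        gcongr
        linarith [h2]
    _ ≤ P * (P * x ^ 2) := by gcongr
    _ = _ := by ring

variable (order : ∀ v : Fin n, Fin (G.degree v) ≃ G.neighborSet v)

theorem degree_le_card (v : Fin n) : (graphOracle G order).deg v ≤ n :=
  (G.degree_lt_card_verts v).le.trans_eq (Fintype.card_fin n)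

theorem expCost_adjSearch_le (O : Oracle n) (v : Fin n) (r : ℕ) (T : Finset (Fin n))
    (next : Bool → Algorithm n) {X : ℝ} (h : ∀ b, (next b).expCost O ≤ X) :
    (adjSearch v r T next).expCost O ≤ 4 * r * √T.card + X := by
  simpa [Gate.cost, adjSearch] using expCost_search_le O (adjIndex v) (adjIndex_injective v)
    (baseVec v 2) (adjIndex_ne v) [.adjQuery] r T next h

theorem expCost_nbrSearch_le (O : Oracle n) (v : Fin n) (r d : ℕ) (T : Finset (Fin n))
    (next : Bool → Algorithm n) {X : ℝ} (h : ∀ b, (next b).expCost O ≤ X) :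
    (nbrSearch v r d T next).expCost O ≤ 8 * r * √d + X := by
  refine (expCost_search_le O (nbrIndex v) (nbrIndex_injective v) (baseVec v 2)
    (nbrIndex_ne v) _ r _ next h).trans ?_
  have h1 : (Finset.univ.filter fun j : Fin n => (j : ℕ) < d).card ≤ d := by
    refine (Finset.card_le_card_of_injOn (t := Finset.range d) Fin.val (fun j hj => ?_)
      Fin.val_injective.injOn).trans_eq (Finset.card_range d)
    simpa using hj
  have h2 : √((Finset.univ.filter fun j : Fin n => (j : ℕ) < d).card : ℝ) ≤ √d :=
    Real.sqrt_le_sqrt (by exact_mod_cast h1)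
  simp only [List.map_cons, List.map_nil, Gate.cost, List.sum_cons, List.sum_nil]
  push_cast
  nlinarith [mul_le_mul_of_nonneg_left h2 (Nat.cast_nonneg r : (0 : ℝ) ≤ r)]

theorem expCost_coloringAlgorithm_le (ε : ℝ) {x : ℝ} (hx : 0 ≤ x) (hxn : x ^ 4 = n) :
    (coloringAlgorithm n ε).expCost (graphOracle G order)
      ≤ n + 24 * trialFactor ε G.maxDegree * logFactor n ^ 2 * (n * x) := by
  set O := graphOracle G order with hO
  -- Only the cost half of the specification is used, so the event `∅` is arbitrary.
  rw [coloringAlgorithm, (readDegrees_spec O (degree_le_card G order) ∅ _ _ _ (by simp)).2,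
    List.length_finRange]
  have hsup : Finset.univ.sup O.deg = G.maxDegree := sup_degree_eq G
  rw [hsup, greedyColoring]
  gcongr
  set Δ := G.maxDegree with hΔ
  set r := 3 * logFactor n with hr
  have hrpos : (0 : ℝ) ≤ 8 * r * x := by positivity
  have main : (greedy (conflictSearch (decide (Δ ^ 2 ≤ n)) r O.deg) (numColors ε Δ)
      (trialFactor ε Δ * logFactor n) (List.finRange n) fun _ => none).expCost O
      ≤ (List.finRange n).length * ((trialFactor ε Δ * logFactor n : ℕ) * (8 * r * x)) := by
    by_cases hd : Δ ^ 2 ≤ n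
    · refine expCost_greedy_le O _ _ (fun _ => 8 * r * x) _ ?_ ?_ hrpos _ _ _
      · intro v T nx X h
        rw [conflictSearch, if_pos (decide_eq_true hd)]
        refine (expCost_nbrSearch_le O v r _ T nx h).trans ?_
        gcongr
        have h1 : O.deg v ≤ Δ := G.degree_le_maxDegree v
        have h2 : (Δ : ℝ) ^ 2 ≤ (x ^ 2) ^ 2 := by
          rw [← pow_mul, hxn]; exact_mod_cast hd
        have h3 : (Δ : ℝ) ≤ x ^ 2 :=
          (pow_le_pow_iff_left₀ (Nat.cast_nonneg _) (by positivity) two_ne_zero).1 h2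
        rw [Real.sqrt_le_left hx]
        exact le_trans (by exact_mod_cast h1) h3
      · intro col
        simp
    · refine expCost_greedy_le O _ _ (fun T => 4 * r * √T.card) _ ?_ ?_ hrpos _ _ _
      · intro v T nx X h
        rw [conflictSearch, if_neg (by simpa using hd)]
        exact expCost_adjSearch_le O v r T nx h
      · intro col
        have h2 : (x ^ 2) ^ 2 ≤ (Δ : ℝ) ^ 2 := by
          rw [← pow_mul, hxn]; exact_mod_cast (not_le.1 hd).le
        have h3 : x ^ 2 ≤ (Δ : ℝ) :=
          (pow_le_pow_iff_left₀ (by positivity) (Nat.cast_nonneg _) two_ne_zero).1 h2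
        have h4 : x ^ 2 ≤ (numColors ε Δ : ℝ) :=
          h3.trans (by exact_mod_cast (lt_numColors ε Δ).le)
        rw [← Finset.mul_sum]
        have h5 := sum_sqrt_card_colorClass_le hx hxn h4 col
        calc _ ≤ 4 * (r : ℝ) * (numColors ε Δ * x) := by gcongr
          _ ≤ 8 * (r : ℝ) * (numColors ε Δ * x) := by gcongr; norm_num
          _ = _ := by ring
  refine main.trans (le_of_eq ?_)
  rw [List.length_finRange, hr]
  push_cast
  ring

theorem mul_half_pow_logFactor_le (n : ℕ) : (n : ℝ) * (1 / 2) ^ logFactor n ≤ 1 / 16 := by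
  have h : n ≤ 2 ^ Nat.size n := (Nat.lt_size_self n).le
  have h' : (n : ℝ) ≤ 2 ^ Nat.size n := by exact_mod_cast h
  rw [logFactor, one_div, inv_pow, ← div_eq_mul_inv, div_le_iff₀ (by positivity), pow_add]
  linarith

theorem prob_coloringAlgorithm_ge (hn : 0 < n) (ε : ℝ) :
    7 / 8 ≤ (coloringAlgorithm n ε).prob (graphOracle G order)
      {c | IsProperColoring G (numColors ε G.maxDegree) c} := by
  set O := graphOracle G order with hO
  rw [coloringAlgorithm, (readDegrees_spec O (degree_le_card G order) _ _ _ _ (by simp)).1]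
  have hsup : Finset.univ.sup O.deg = G.maxDegree := sup_degree_eq G
  rw [hsup, greedyColoring]
  set Δ := G.maxDegree with hΔ
  set L := logFactor n with hL
  set q := trialFactor ε Δ with hq
  have hfind : ∀ v T nx, (nx (decide (∃ u ∈ T, G.Adj v u)) : Algorithm n).prob O
      {c | IsProperColoring G (numColors ε Δ) c} - (1 / 2) ^ (3 * L)
      ≤ (conflictSearch (decide (Δ ^ 2 ≤ n)) (3 * L) O.deg v T nx).prob O
        {c | IsProperColoring G (numColors ε Δ) c} := by
    intro v T nx
    rw [conflictSearch]
    split_ifs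
    · exact prob_nbrSearch_ge G order _ v _ T nx
    · exact prob_adjSearch_ge G order _ v _ T nx
  refine le_trans ?_ (prob_greedy_ge G O _ _ (by positivity) hfind _ _ _ (by simp) (by simp))
  rw [List.length_finRange]
  have h1 := div_numColors_pow_le ε Δ L
  have h2 := mul_half_pow_logFactor_le n
  have h3 : (q : ℝ) ≤ n := by
    have : Δ < n := by
      have : Nonempty (Fin n) := ⟨⟨0, hn⟩⟩
      obtain ⟨v, hv⟩ := G.exists_maximal_degree_vertex
      rw [hΔ, hv]
      exact (G.degree_lt_card_verts v).trans_eq (Fintype.card_fin n)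
    exact_mod_cast (trialFactor_le_succ ε Δ).trans this
  set h : ℝ := (1 / 2) ^ L with hh
  have hpos : 0 ≤ h := by positivity
  have h4 : L * h ≤ 1 := by
    have : (L : ℝ) ≤ 2 ^ L := by exact_mod_cast (Nat.lt_two_pow_self (n := L)).le
    rw [hh, one_div, inv_pow, ← div_eq_mul_inv, div_le_one (by positivity)]
    exact this
  -- There are at most `n * q * L` searches; the three factors `2^(-L)` absorb `n`, `q ≤ n` and `L`.
  -- The total failure is at most `1/256 + 1/16 < 1/8`.
  have h5 : (1 / 2 : ℝ) ^ (3 * L) = h * h * h := by rw [mul_comm, pow_mul]; ring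
  rw [h5]
  push_cast
  have h6 : q * h ≤ 1 / 16 := (mul_le_mul_of_nonneg_right h3 hpos).trans h2
  have h7 : (n * h) * ((q * h) * (L * h)) ≤ 1 / 16 * (1 / 16 * 1) := by gcongr
  have h8 : (n : ℝ) * ((Δ : ℝ) / numColors ε Δ) ^ (q * L) ≤ n * h := by gcongr
  nlinarith

theorem logFactor_le (hn : 2 ≤ n) : (logFactor n : ℝ) ≤ 9 * Real.log n := by
  have h1 : 2 ^ (Nat.size n - 1) ≤ n := by
    have : 0 < Nat.size n := Nat.size_pos.2 (by omega)
    exact Nat.lt_size.1 (by omega)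
  have h2 : ((Nat.size n - 1 : ℕ) : ℝ) * Real.log 2 ≤ Real.log n := by
    rw [← Real.log_pow]
    exact Real.log_le_log (by positivity) (by exact_mod_cast h1)
  have h3 : Real.log 2 ≤ Real.log n := Real.log_le_log (by norm_num) (by exact_mod_cast hn)
  have h4 := Real.log_two_gt_d9
  have h5 : (Nat.size n : ℝ) ≤ (Nat.size n - 1 : ℕ) + 1 := by
    exact_mod_cast (by omega : Nat.size n ≤ Nat.size n - 1 + 1)
  rw [logFactor]
  push_cast
  nlinarith [(Nat.cast_nonneg _ : (0 : ℝ) ≤ (Nat.size n - 1 : ℕ))]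

/-- The degree queries are absorbed by `1 ≤ ε₀ / ε` and `1 ≤ 4 log² n`; `1944 = 24 * 9²` comes from
`logFactor_le`. -/
theorem cost_bound {ε ε₀ x : ℝ} (hε : 0 < ε) (hε₀ : ε ≤ ε₀) (hn : 2 ≤ n) (hx : 1 ≤ x) (Δ : ℕ) :
    n + 24 * trialFactor ε Δ * (logFactor n : ℝ) ^ 2 * (n * x)
      ≤ (4 * ε₀ + 1944 * (2 * ε₀ + 2)) * ε⁻¹ * (n * x) * Real.log n ^ 2 := by
  have h1 := logFactor_le hn
  have h2 : 1 ≤ 4 * Real.log n ^ 2 := by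
    have h3 : Real.log 2 ≤ Real.log n := Real.log_le_log (by norm_num) (by exact_mod_cast hn)
    have := Real.log_two_gt_d9
    nlinarith
  have h3 : 1 ≤ ε₀ * ε⁻¹ := by rw [← div_eq_mul_inv, one_le_div hε]; exact hε₀
  have h4 : (trialFactor ε Δ : ℝ) ≤ (2 * ε₀ + 2) * ε⁻¹ := by
    have h5 := trialFactor_le hε Δ
    rw [div_eq_mul_inv] at h5
    linarith
  have hn0 : (0 : ℝ) ≤ n := Nat.cast_nonneg _
  have hε₀' : 0 < ε₀ := hε.trans_le hε₀
  have h5 : (n : ℝ) ≤ ε₀ * ε⁻¹ * (n * x) * (4 * Real.log n ^ 2) := by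
    calc (n : ℝ) = 1 * (n * 1) * 1 := by ring
      _ ≤ _ := by gcongr
  have h6 : 24 * (trialFactor ε Δ : ℝ) * (logFactor n : ℝ) ^ 2 * (n * x)
      ≤ 24 * ((2 * ε₀ + 2) * ε⁻¹) * (9 * Real.log n) ^ 2 * (n * x) := by
    gcongr
  linarith

end Coloring

end QuantumQuery

/-! ### Truncation of the expected-cost algorithm. -/

theorem mainTheorem6 :
    ∃ k : ℕ, ∀ ε₀ : ℝ, 0 < ε₀ → ∃ C : ℝ, 0 < C ∧
      ∀ (n : ℕ) (ε : ℝ), 0 < ε → ε ≤ ε₀ →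
        ∃ A : QuantumQuery.Algorithm n,
          (A.queries : ℝ) ≤ C * ε⁻¹ * (n : ℝ) ^ (5 / 4 : ℝ) * Real.log n ^ k ∧
          ∀ (G : SimpleGraph (Fin n)) [DecidableRel G.Adj]
            (order : ∀ v : Fin n, Fin (G.degree v) ≃ G.neighborSet v),
            2 / 3 ≤ A.prob (QuantumQuery.graphOracle G order)
              {c | QuantumQuery.IsProperColoring G (QuantumQuery.numColors ε G.maxDegree) c} := by
  refine ⟨2, fun ε₀ hε₀ => ⟨8 * (4 * ε₀ + 1944 * (2 * ε₀ + 2)), by positivity,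
    fun n ε hε hεε₀ => ?_⟩⟩
  -- For `n ≤ 1` the logarithm is `0`, so no query is allowed; there are no edges to color.
  rcases Nat.lt_or_ge n 2 with hn | hn
  · refine ⟨.output 0, ?_, fun G _ order => ?_⟩
    · simp only [QuantumQuery.Algorithm.queries, Nat.cast_zero]
      positivity
    · have : QuantumQuery.IsProperColoring G (QuantumQuery.numColors ε G.maxDegree) 0 :=
        ⟨fun v => Nat.zero_lt_of_lt (QuantumQuery.lt_numColors ε _), fun u v huv =>
          absurd (Fin.ext (by omega)) huv.ne⟩
      simp only [QuantumQuery.Algorithm.prob, Set.mem_ofPred_eq, this, if_true]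
      norm_num
  · set x : ℝ := (n : ℝ) ^ (1 / 4 : ℝ) with hx
    have hn0 : (0 : ℝ) < n := by exact_mod_cast (by omega : 0 < n)
    have hx1 : 1 ≤ x := Real.one_le_rpow (by exact_mod_cast (by omega : 1 ≤ n)) (by norm_num)
    have hx4 : x ^ 4 = n := by
      rw [hx, ← Real.rpow_natCast, ← Real.rpow_mul hn0.le]; norm_num
    have hx5 : (n : ℝ) ^ (5 / 4 : ℝ) = n * x := by
      rw [hx, ← Real.rpow_one_add' hn0.le (by norm_num)]; norm_num
    rw [hx5]
    -- The budget is eight times the bound on the expected cost, so truncation loses at most `1/8`,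
    -- and `7/8 - 1/8 ≥ 2/3`.
    set D : ℝ := 8 * (4 * ε₀ + 1944 * (2 * ε₀ + 2)) * ε⁻¹ * (n * x) * Real.log n ^ 2 with hD
    have hD0 : 0 ≤ D := by positivity
    refine ⟨(QuantumQuery.coloringAlgorithm n ε).truncate ⌊D⌋₊, ?_, fun G _ order => ?_⟩
    · exact le_trans (by exact_mod_cast QuantumQuery.Algorithm.queries_truncate_le _ _)
        (Nat.floor_le hD0)
    · have h1 := QuantumQuery.prob_coloringAlgorithm_ge G order (by omega) ε
      have h2 := QuantumQuery.expCost_coloringAlgorithm_le G order ε (by linarith) hx4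
      have h3 := QuantumQuery.cost_bound hε hεε₀ hn hx1 G.maxDegree
      have h4 := QuantumQuery.Algorithm.prob_sub_prob_truncate_le
        (QuantumQuery.graphOracle G order)
        {c | QuantumQuery.IsProperColoring G (QuantumQuery.numColors ε G.maxDegree) c}
        (QuantumQuery.coloringAlgorithm n ε) ⌊D⌋₊
      have h5 := Nat.lt_floor_add_one D
      have h6 : (QuantumQuery.coloringAlgorithm n ε).expCost (QuantumQuery.graphOracle G order)
          ≤ (⌊D⌋₊ + 1) * (1 / 8) := by
        refine (h2.trans h3).trans ?_
        have : (4 * ε₀ + 1944 * (2 * ε₀ + 2)) * ε⁻¹ * (n * x) * Real.log n ^ 2 = D * (1 / 8) := by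
          rw [hD]; ring
        rw [this]
        linarith
      have h7 := le_of_mul_le_mul_left (h4.trans h6) (by positivity)
      linarith
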